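/- For a function $g:[0,\infty)\to[0,\infty)$ that is non-decreasing with $g(0)=0$ and a real random variable $X$, put $\|X\|_g=\inf\{\eta>0:\mathbb{E}[g(|X|/\eta)]\le 1\}\in[0,\infty]$ (with $\inf\emptyset=\infty$). For $\alpha>0$ let $\psi_\alpha(x)=\exp(x^\alpha)-1$, $x\ge 0$. For $\alpha>0$ and $L\ge 0$ let $\Psi_{\alpha,L}:[0,\infty)\to[0,\infty)$ be the function whose inverse is $$\Psi_{\alpha,L}^{-1}(t)=\sqrt{\log(1+t)}+L\,(\log(1+t))^{1/\alpha},\qquad t\ge 0;$$ $\|X\|_{\Psi_{\alpha,L}}$ is called the Generalized Bernstein–Orlicz (GBO) norm of $X$. **Theorem.** Let $X_1,\dots,X_n$ be independent mean-zero real random variables such that $\|X_i\|_{\psi_\alpha}<\infty$ for all $1\le i\le n$, for some $\alpha>0$. Let $a=(a_1,\dots,a_n)\in\mathbb{R}^n$ be any vector and put $b=(a_1\|X_1\|_{\psi_\alpha},\dots,a_n\|X_n\|_{\psi_\alpha})\in\mathbb{R}^n$. Then $$\Big\|\sum_{i=1}^n a_iX_i\Big\|_{\Psi_{\alpha,L_n(\alpha)}}\le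 2e\,C(\alpha)\,\|b\|_2,$$ where $$C(\alpha)=\max\{\sqrt2,2^{1/\alpha}\}\times\begin{cases}\sqrt8\,e^3(2\pi)^{1/4}e^{1/24}\big(e^{2/e}/\alpha\big)^{1/\alpha},&\alpha<1,\\ 4e+2(\log 2)^{1/\alpha},&\alpha\ge 1,\end{cases}$$ and $$L_n(\alpha)=\frac{4^{1/\alpha}}{\sqrt2\,\|b\|_2}\times\begin{cases}\|b\|_\infty,&\alpha<1,\\ 4e\|b\|_\beta/C(\alpha),&\alpha\ge 1.\end{cases}$$ For $\alpha\ge 1$, $\beta\in[1,\infty]$ is the Hölder conjugate of $\alpha$, $1/\alpha+1/\beta=1$ (so $\beta=\infty$ if $\alpha=1$). If $b=0$, $L_n(\alpha)$ is read as $0$. -/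

import Mathlib

open MeasureTheory ProbabilityTheory
open scoped ENNReal

namespace GBO

noncomputable section

/-- The `g`-Orlicz norm `inf {η > 0 : 𝔼[g(|X|/η)] ≤ 1}` of a real random variable `X`, for a
non-decreasing `g : [0, ∞) → [0, ∞)` with `g 0 = 0`. It is `∞` if there is no such `η`. Only the
values of `g` on `[0, ∞)` matter. -/
def orliczNorm {Ω : Type*} [MeasurableSpace Ω] (g : ℝ → ℝ) (X : Ω → ℝ) (μ : Measure Ω) : ℝ≥0∞ :=
  sInf {c : ℝ≥0∞ | ∃ η : ℝ, 0 < η ∧ c = ENNReal.ofReal η ∧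
    ∫⁻ ω, ENNReal.ofReal (g (|X ω| / η)) ∂μ ≤ 1}

/-- `ψ_α(x) = exp(x^α) - 1` for `x ≥ 0`. -/
def psi (α : ℝ) (x : ℝ) : ℝ := Real.exp (x ^ α) - 1

/-- `Ψ_{α,L}⁻¹(t) = √(log(1+t)) + L (log(1+t))^{1/α}` for `t ≥ 0`. -/
def gboInv (α L : ℝ) (t : ℝ) : ℝ :=
  Real.sqrt (Real.log (1 + t)) + L * (Real.log (1 + t)) ^ (1 / α)

/-- `Ψ_{α,L} : [0, ∞) → [0, ∞)`, the inverse of the bijection `gboInv α L` of `[0, ∞)`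
(see `gboInv_bijOn`, `gboPsi_gboInv`, `gboInv_gboPsi`). -/
def gboPsi (α L : ℝ) : ℝ → ℝ := Function.invFunOn (gboInv α L) (Set.Ici 0)

theorem gboInv_bijOn {α L : ℝ} (hα : 0 < α) (hL : 0 ≤ L) :
    Set.BijOn (gboInv α L) (Set.Ici 0) (Set.Ici 0) := by
  have hlog : ∀ t : ℝ, 0 ≤ t → 0 ≤ Real.log (1 + t) := fun t ht =>
    Real.log_nonneg (by linarith)
  have hmono : StrictMonoOn (gboInv α L) (Set.Ici 0) := by
    intro s hs t ht hst
    have hs' : (0 : ℝ) ≤ s := hs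
    have h1 : Real.log (1 + s) < Real.log (1 + t) :=
      Real.log_lt_log (by linarith) (by linarith)
    have h2 := Real.sqrt_lt_sqrt (hlog s hs) h1
    have h3 : Real.log (1 + s) ^ (1 / α) ≤ Real.log (1 + t) ^ (1 / α) :=
      Real.rpow_le_rpow (hlog s hs) h1.le (by positivity)
    have h4 := mul_le_mul_of_nonneg_left h3 hL
    unfold gboInv
    linarith
  refine ⟨?_, hmono.injOn, ?_⟩
  · intro t ht
    exact add_nonneg (Real.sqrt_nonneg _) (mul_nonneg hL (Real.rpow_nonneg (hlog t ht) _))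
  · intro y hy
    have hy' : (0 : ℝ) ≤ y := hy
    have hT : (0 : ℝ) ≤ Real.exp (y ^ 2) - 1 := by
      have := Real.one_le_exp (sq_nonneg y)
      linarith
    have hcont : ContinuousOn (gboInv α L) (Set.Icc 0 (Real.exp (y ^ 2) - 1)) := by
      have hl : ContinuousOn (fun t : ℝ => Real.log (1 + t))
          (Set.Icc 0 (Real.exp (y ^ 2) - 1)) :=
        ContinuousOn.log (by fun_prop) (fun t ht => by have := ht.1; linarith)
      exact hl.sqrt.add (continuousOn_const.mul
        (hl.rpow_const (fun t _ => Or.inr (by positivity))))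
    have h0 : gboInv α L 0 ≤ y := by
      have : (1 / α) ≠ 0 := by positivity
      simp only [gboInv, add_zero, Real.log_one, Real.sqrt_zero, Real.zero_rpow this, mul_zero]
      exact hy'
    have h1 : y ≤ gboInv α L (Real.exp (y ^ 2) - 1) := by
      have h2 : Real.log (1 + (Real.exp (y ^ 2) - 1)) = y ^ 2 := by
        rw [add_sub_cancel, Real.log_exp]
      unfold gboInv
      rw [h2, Real.sqrt_sq hy']
      have := mul_nonneg hL (Real.rpow_nonneg (sq_nonneg y) (1 / α))
      linarith
    obtain ⟨t, ht, hty⟩ := intermediate_value_Icc hT hcont ⟨h0, h1⟩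
    exact ⟨t, ht.1, hty⟩

theorem gboPsi_gboInv {α L : ℝ} (hα : 0 < α) (hL : 0 ≤ L) {t : ℝ} (ht : 0 ≤ t) :
    gboPsi α L (gboInv α L t) = t :=
  (gboInv_bijOn hα hL).invOn_invFunOn.1 ht

theorem gboInv_gboPsi {α L : ℝ} (hα : 0 < α) (hL : 0 ≤ L) {x : ℝ} (hx : 0 ≤ x) :
    gboInv α L (gboPsi α L x) = x :=
  (gboInv_bijOn hα hL).invOn_invFunOn.2 hx

/-- The norm `‖b‖_p` of `b ∈ ℝⁿ`, for `p ∈ [1, ∞]`. -/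
def vecNorm {n : ℕ} (p : ℝ≥0∞) (b : Fin n → ℝ) : ℝ := ‖WithLp.toLp p b‖

/-- The constant `C(α)`. -/
def constC (α : ℝ) : ℝ :=
  max (Real.sqrt 2) ((2 : ℝ) ^ (1 / α)) *
    if α < 1 then
      Real.sqrt 8 * Real.exp 3 * (2 * Real.pi) ^ ((1 : ℝ) / 4) * Real.exp (1 / 24) *
        (Real.exp (2 / Real.exp 1) / α) ^ (1 / α)
    else 4 * Real.exp 1 + 2 * (Real.log 2) ^ (1 / α)

/-- The parameter `L_n(α)` as a function of `b`. For `α ≥ 1` it uses the Hölder conjugate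
`β ∈ [1, ∞]` of `α`, with `β = ∞` for `α = 1`. (It is `0` for `b = 0`.) -/
def paramL {n : ℕ} (α : ℝ) (b : Fin n → ℝ) : ℝ :=
  (4 : ℝ) ^ (1 / α) / (Real.sqrt 2 * vecNorm 2 b) *
    if α < 1 then vecNorm ∞ b
    else 4 * Real.exp 1 * vecNorm (ENNReal.conjExponent (ENNReal.ofReal α)) b / constC α

end

end GBO

namespace GBO

noncomputable section

/-! After dividing each `X i` by its norm, the sum is a.e. `∑ b i * Z i` with `𝔼[exp(|Z i| ^ α)] ≤
2`. For `α < 1` the moment generating function may be infinite, so it is replaced by `momentSeries`,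
its series of absolute values of moments cut at order `N`. The binomial formula makes this series
submultiplicative over independent sums (`momentSeries_sum_le`), so the Chernoff scheme survives: if
the series of `S` is at most `e ^ N` with `N` even, its last term alone bounds `𝔼[S ^ N]`, and
Markov gives `ℙ(|S| ≥ e² N / l) ≤ e ^ (-N)`.

For one summand, centring removes the first-order term, and the logarithm of the series is at most a
multiple of `(l |b i|)²` in the Gaussian range. For `α ≤ 1` that range is `l |b i| ≲ N ^ (1 - 1/α)`,
where the terms decay geometrically. For `α ≥ 1` it is `l |b i| ≤ 1`, and beyond it Young's
inequality gives `2 (l |b i|) ^ β`. Taking `l = 1 / (p + q)`, with `p` paying for the Gaussian part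
and `q` for the rest, yields a threshold with a `√N` term and an `N ^ (1/α)` term, the shape of
`gboInv`.

With `N` the largest even integer below `9 s`, `s = log (1 + t)`, the tail is at most `e² (1 + t) ^
(-9)`. Its integral is `e² / 8 < 1`, so the layer-cake formula bounds the GBO norm
(`orliczNorm_gboPsi_le_of_tail`). It remains to compare constants. -/

variable {Ω : Type*} [MeasurableSpace Ω] {μ : Measure Ω}

/-! ### Truncated moment series and the Chernoff scheme -/

/-- The truncated exponential series `∑_{k ≤ N} l ^ k |𝔼[Y ^ k]| / k!` of the moments of `Y`. -/
def momentSeries (μ : Measure Ω) (l : ℝ) (N : ℕ) (Y : Ω → ℝ) : ℝ :=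
  ∑ k ∈ Finset.range (N + 1), l ^ k / k.factorial * |∫ ω, Y ω ^ k ∂μ|

theorem momentSeries_nonneg {l : ℝ} (hl : 0 ≤ l) (N : ℕ) (Y : Ω → ℝ) :
    0 ≤ momentSeries μ l N Y :=
  Finset.sum_nonneg fun k _ => by positivity

/-- The triangle `i + j ≤ N` lies inside the square `i, j ≤ N`, and the terms left over are
nonnegative. This is why truncation does not spoil submultiplicativity. -/
theorem sum_range_le_mul_of_le_antidiagonal {u v w : ℕ → ℝ} (hu : ∀ k, 0 ≤ u k)
    (hv : ∀ k, 0 ≤ v k) (h : ∀ k, w k ≤ ∑ p ∈ Finset.HasAntidiagonal.antidiagonal k, u p.1 * v p.2) (N : ℕ) :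
    ∑ k ∈ Finset.range (N + 1), w k ≤
      (∑ k ∈ Finset.range (N + 1), u k) * ∑ k ∈ Finset.range (N + 1), v k := by
  rw [Finset.sum_mul_sum, ← Finset.sum_product']
  refine (Finset.sum_le_sum fun k _ => h k).trans ?_
  rw [Finset.sum_sigma']
  refine (Finset.sum_nbij' (fun x => x.2) (fun p => ⟨p.1 + p.2, p⟩)
    (t := ((Finset.range (N + 1)) ×ˢ (Finset.range (N + 1))).filter (fun p => p.1 + p.2 ≤ N))
    (g := fun p => u p.1 * v p.2) ?_ ?_ ?_ ?_ ?_).le.trans ?_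
  · rintro ⟨k, p⟩ hp
    simp only [Finset.mem_sigma, Finset.mem_range, Finset.HasAntidiagonal.mem_antidiagonal, Finset.mem_filter,
      Finset.mem_product] at hp ⊢
    omega
  · rintro p hp
    simp only [Finset.mem_sigma, Finset.mem_range, Finset.HasAntidiagonal.mem_antidiagonal, Finset.mem_filter,
      Finset.mem_product] at hp ⊢
    exact ⟨by omega, trivial⟩
  · rintro ⟨k, p⟩ hp
    simp only [Finset.mem_sigma, Finset.HasAntidiagonal.mem_antidiagonal] at hp
    obtain ⟨-, rfl⟩ := hp
    rfl
  · intro p _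
    rfl
  · intro x _
    rfl
  · exact Finset.sum_le_sum_of_subset_of_nonneg (Finset.filter_subset _ _)
      fun p _ _ => mul_nonneg (hu _) (hv _)

theorem memLp_integrable_pow [IsProbabilityMeasure μ] {Y : Ω → ℝ} (hY : ∀ k : ℕ, MemLp Y k μ)
    (k : ℕ) : Integrable (fun ω => Y ω ^ k) μ := by
  refine (hY k).integrable_norm_pow'.mono ((hY k).1.pow k) ?_
  filter_upwards with ω
  simp

/-- Independence factors each term of the binomial expansion of `𝔼[(Y + Z) ^ k]`; dividing by `k!`
turns the expansion into a Cauchy product. -/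
theorem momentSeries_add_le [IsProbabilityMeasure μ] {l : ℝ} (hl : 0 ≤ l) (N : ℕ)
    {Y Z : Ω → ℝ} (hY : ∀ k : ℕ, MemLp Y k μ) (hZ : ∀ k : ℕ, MemLp Z k μ)
    (hYZ : IndepFun Y Z μ) :
    momentSeries μ l N (Y + Z) ≤ momentSeries μ l N Y * momentSeries μ l N Z := by
  have hind : ∀ i j : ℕ, IndepFun (fun ω => Y ω ^ i) (fun ω => Z ω ^ j) μ := fun i j =>
    hYZ.comp (φ := fun x => x ^ i) (ψ := fun x => x ^ j) (by fun_prop) (by fun_prop)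
  refine sum_range_le_mul_of_le_antidiagonal (fun k => by positivity) (fun k => by positivity)
    (fun k => ?_) N
  have hexp : ∫ ω, (Y + Z) ω ^ k ∂μ = ∑ p ∈ Finset.HasAntidiagonal.antidiagonal k,
      (k.choose p.1 : ℝ) * ((∫ ω, Y ω ^ p.1 ∂μ) * ∫ ω, Z ω ^ p.2 ∂μ) := by
    have h1 : ∀ ω, (Y + Z) ω ^ k = ∑ p ∈ Finset.HasAntidiagonal.antidiagonal k,
        (k.choose p.1 : ℝ) * (Y ω ^ p.1 * Z ω ^ p.2) := fun ω => by
      rw [Pi.add_apply, (Commute.all _ _).add_pow']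
      simp [nsmul_eq_mul]
    simp_rw [h1]
    rw [integral_finsetSum]
    · refine Finset.sum_congr rfl fun p _ => ?_
      rw [integral_const_mul, (hind p.1 p.2).integral_fun_mul_eq_mul_integral
        (memLp_integrable_pow hY _).1 (memLp_integrable_pow hZ _).1]
    · intro p _
      exact ((hind p.1 p.2).integrable_mul (memLp_integrable_pow hY _)
        (memLp_integrable_pow hZ _)).const_mul _
  rw [hexp]
  refine (mul_le_mul_of_nonneg_left (Finset.abs_sum_le_sum_abs _ _) (by positivity)).trans ?_
  rw [Finset.mul_sum]
  refine Finset.sum_le_sum fun p hp => le_of_eq ?_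
  rw [Finset.HasAntidiagonal.mem_antidiagonal] at hp
  have hc : (k.choose p.1 : ℝ) = k.factorial / (p.1.factorial * p.2.factorial) := by
    rw [← hp, Nat.cast_add_choose]
  rw [abs_mul, abs_mul, abs_of_nonneg (by positivity : (0 : ℝ) ≤ k.choose p.1), hc]
  have := Nat.factorial_pos k
  rw [← hp, pow_add]
  field_simp

theorem momentSeries_sum_le [IsProbabilityMeasure μ] {ι : Type*} {l : ℝ}
    (hl : 0 ≤ l) (N : ℕ) {Y : ι → Ω → ℝ} (hmeas : ∀ i, Measurable (Y i))
    (hY : ∀ i, ∀ k : ℕ, MemLp (Y i) k μ) (hind : iIndepFun Y μ) (s : Finset ι) :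
    momentSeries μ l N (∑ i ∈ s, Y i) ≤ ∏ i ∈ s, momentSeries μ l N (Y i) := by
  classical
  induction s using Finset.induction_on with
  | empty =>
    simp only [momentSeries, Finset.sum_empty, Pi.zero_apply, Finset.prod_empty]
    rw [Finset.sum_eq_single 0]
    · simp
    · intro k _ hk
      simp [hk]
    · simp
  | insert i s hi ih =>
    rw [Finset.sum_insert hi, Finset.prod_insert hi]
    refine (momentSeries_add_le hl N (hY i) (fun k => memLp_finsetSum' _ fun j _ => hY j k)
      (hind.indepFun_finsetSum_of_notMem hmeas hi).symm).trans ?_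
    exact mul_le_mul_of_nonneg_left ih (momentSeries_nonneg hl _ _)

/-- Markov's inequality for an even moment controlled by the truncated exponential series. -/
theorem measureReal_ge_le_of_momentSeries_le [IsProbabilityMeasure μ] {l : ℝ} (hl : 0 < l)
    {N : ℕ} (hN : Even N) (hN0 : N ≠ 0) {S : Ω → ℝ} (hS : ∀ k : ℕ, MemLp S k μ)
    (h : momentSeries μ l N S ≤ Real.exp N) :
    μ.real {ω | Real.exp 2 * N / l ≤ |S ω|} ≤ Real.exp (-N) := by
  have hNpos : (0 : ℝ) < N := by positivity
  have h1 : l ^ N / N.factorial * ∫ ω, S ω ^ N ∂μ ≤ Real.exp N := by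
    refine le_trans ?_ h
    refine le_trans (mul_le_mul_of_nonneg_left (le_abs_self _) (by positivity)) ?_
    exact Finset.single_le_sum (f := fun k => l ^ k / (k.factorial : ℝ) * |∫ ω, S ω ^ k ∂μ|)
      (fun k _ => by positivity) (Finset.self_mem_range_succ N)
  -- The crude bound `N! ≤ N ^ N` suffices: only the rate `e N / l` matters.
  have hfac : (N.factorial : ℝ) ≤ (N : ℝ) ^ N := by exact_mod_cast Nat.factorial_le_pow N
  have h2 : ∫ ω, S ω ^ N ∂μ ≤ (Real.exp 1 * N / l) ^ N := by
    have h3 : ∫ ω, S ω ^ N ∂μ ≤ Real.exp N * (N.factorial / l ^ N) := by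
      rw [← div_le_iff₀ (by positivity)]
      refine le_trans (le_of_eq ?_) h1
      field_simp
    refine h3.trans ?_
    rw [div_pow, mul_pow, ← Real.exp_nat_mul, mul_one, mul_div_assoc]
    gcongr
  have hmark := mul_meas_ge_le_integral_of_nonneg (μ := μ) (f := fun ω => S ω ^ N)
    (Filter.Eventually.of_forall fun ω => hN.pow_nonneg _) (memLp_integrable_pow hS N)
    ((Real.exp 2 * N / l) ^ N)
  have hsub : μ.real {ω | Real.exp 2 * N / l ≤ |S ω|} ≤
      μ.real {ω | (Real.exp 2 * N / l) ^ N ≤ S ω ^ N} := by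
    refine measureReal_mono fun ω hω => ?_
    rw [Set.mem_ofPred_eq] at hω ⊢
    rw [← hN.pow_abs (S ω)]
    exact pow_le_pow_left₀ (by positivity) hω N
  have hfinal : (Real.exp 2 * N / l) ^ N * μ.real {ω | (Real.exp 2 * N / l) ^ N ≤ S ω ^ N} ≤
      (Real.exp 1 * N / l) ^ N := hmark.trans h2
  have hsplit : (Real.exp 1 * N / l) ^ N = (Real.exp 2 * N / l) ^ N * Real.exp (-N) := by
    have : Real.exp (-N) = Real.exp (-1) ^ N := by rw [← Real.exp_nat_mul]; ring_nf
    rw [this, ← mul_pow]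
    congr 1
    have : Real.exp 1 = Real.exp 2 * Real.exp (-1) := by rw [← Real.exp_add]; norm_num
    rw [this]
    ring
  rw [hsplit] at hfinal
  exact hsub.trans (le_of_mul_le_mul_left hfinal (by positivity))

/-! ### Moments under exponential integrability -/

/-- The constant is the maximum of `y ^ q * exp (-y)`, attained at `y = q`. -/
theorem rpow_le_mul_exp {y q : ℝ} (hy : 0 ≤ y) (hq : 0 < q) :
    y ^ q ≤ (q / Real.exp 1) ^ q * Real.exp y := by
  have h1 : y / q ≤ Real.exp (y / q - 1) := by
    have := Real.add_one_le_exp (y / q - 1)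
    linarith
  calc y ^ q = q ^ q * (y / q) ^ q := by
        rw [← Real.mul_rpow hq.le (by positivity), mul_div_cancel₀ _ hq.ne']
    _ ≤ q ^ q * Real.exp (y / q - 1) ^ q := by gcongr
    _ = (q / Real.exp 1) ^ q * Real.exp y := by
        rw [Real.div_rpow hq.le (Real.exp_pos _).le, ← Real.exp_mul, ← Real.exp_mul, one_mul,
          div_mul_eq_mul_div, mul_div_assoc, ← Real.exp_sub]
        congr 2
        field_simp

theorem pow_le_mul_exp_rpow {α x : ℝ} (hα : 0 < α) (hx : 0 ≤ x) {k : ℕ} (hk : k ≠ 0) :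
    x ^ k ≤ (k / (α * Real.exp 1)) ^ (k / α) * Real.exp (x ^ α) := by
  have hk' : (0 : ℝ) < k := by positivity
  have h := rpow_le_mul_exp (Real.rpow_nonneg hx α) (div_pos hk' hα)
  rwa [← Real.rpow_mul hx, mul_div_cancel₀ _ hα.ne', Real.rpow_natCast, div_div] at h

theorem integrable_abs_pow_of_exp {α : ℝ} (hα : 0 < α) {Z : Ω → ℝ} (hZ : Measurable Z)
    (hint : Integrable (fun ω => Real.exp (|Z ω| ^ α)) μ) {k : ℕ} (hk : k ≠ 0) :
    Integrable (fun ω => |Z ω| ^ k) μ := by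
  refine (hint.const_mul ((k / (α * Real.exp 1)) ^ (k / α))).mono' (by fun_prop) ?_
  filter_upwards with ω
  rw [Real.norm_eq_abs, abs_of_nonneg (by positivity)]
  exact pow_le_mul_exp_rpow hα (abs_nonneg _) hk

theorem memLp_of_exp {α : ℝ} (hα : 0 < α) {Z : Ω → ℝ} (hZ : Measurable Z)
    (hint : Integrable (fun ω => Real.exp (|Z ω| ^ α)) μ) (k : ℕ) : MemLp Z k μ := by
  rcases eq_or_ne k 0 with rfl | hk
  · simpa using hZ.aestronglyMeasurable
  · rw [← integrable_norm_rpow_iff hZ.aestronglyMeasurable (by exact_mod_cast hk) (by simp)]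
    simpa using integrable_abs_pow_of_exp hα hZ hint hk

theorem integral_abs_pow_le {α : ℝ} (hα : 0 < α) {Z : Ω → ℝ} (hZ : Measurable Z)
    (hint : Integrable (fun ω => Real.exp (|Z ω| ^ α)) μ)
    (h2 : ∫ ω, Real.exp (|Z ω| ^ α) ∂μ ≤ 2) {k : ℕ} (hk : k ≠ 0) :
    ∫ ω, |Z ω| ^ k ∂μ ≤ 2 * (k / (α * Real.exp 1)) ^ (k / α) := by
  calc ∫ ω, |Z ω| ^ k ∂μ
      ≤ ∫ ω, (k / (α * Real.exp 1)) ^ (k / α) * Real.exp (|Z ω| ^ α) ∂μ :=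
        integral_mono (integrable_abs_pow_of_exp hα hZ hint hk) (hint.const_mul _)
          fun ω => pow_le_mul_exp_rpow hα (abs_nonneg _) hk
    _ ≤ (k / (α * Real.exp 1)) ^ (k / α) * 2 := by
        rw [integral_const_mul]
        gcongr
    _ = _ := mul_comm _ _

theorem momentSeries_const_mul_le {l : ℝ} (hl : 0 ≤ l) (N : ℕ) (b : ℝ) (Z : Ω → ℝ) :
    momentSeries μ l N (fun ω => b * Z ω) ≤
      ∑ k ∈ Finset.range (N + 1), (l * |b|) ^ k / k.factorial * ∫ ω, |Z ω| ^ k ∂μ := by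
  refine Finset.sum_le_sum fun k _ => ?_
  simp_rw [mul_pow]
  rw [integral_const_mul, abs_mul, abs_pow]
  have : |∫ ω, Z ω ^ k ∂μ| ≤ ∫ ω, |Z ω| ^ k ∂μ := by
    simpa only [abs_pow] using abs_integral_le_integral_abs (f := fun ω => Z ω ^ k) (μ := μ)
  calc l ^ k / k.factorial * (|b| ^ k * |∫ ω, Z ω ^ k ∂μ|)
      ≤ l ^ k / k.factorial * (|b| ^ k * ∫ ω, |Z ω| ^ k ∂μ) := by gcongr
    _ = _ := by ring

/-- The term `k = 1` vanishes because the series uses `|𝔼[Y ^ k]|` rather than `𝔼[|Y| ^ k]`;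
absolute moments are introduced only from order two on. -/
theorem momentSeries_const_mul_le_of_mean_zero [IsProbabilityMeasure μ] {l : ℝ} (hl : 0 ≤ l)
    {N : ℕ} (b : ℝ) {Z : Ω → ℝ} (hmean : ∫ ω, Z ω ∂μ = 0) :
    momentSeries μ l N (fun ω => b * Z ω) ≤
      1 + ∑ k ∈ Finset.Icc 2 N, (l * |b|) ^ k / k.factorial * ∫ ω, |Z ω| ^ k ∂μ := by
  have hsplit : ∀ f : ℕ → ℝ, f 0 = 1 → f 1 = 0 → (∀ k, 0 ≤ f k) →
      ∑ k ∈ Finset.range (N + 1), f k ≤ 1 + ∑ k ∈ Finset.Icc 2 N, f k := by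
    intro f h0 h1 hf
    -- Only an inequality holds here: for `N = 0` the index `1` is outside the range.
    calc ∑ k ∈ Finset.range (N + 1), f k
        ≤ ∑ k ∈ {0, 1} ∪ Finset.Icc 2 N, f k := by
          refine Finset.sum_le_sum_of_subset_of_nonneg (fun k hk => ?_) fun k _ _ => hf k
          simp only [Finset.mem_range, Finset.mem_union, Finset.mem_insert,
            Finset.mem_singleton, Finset.mem_Icc] at hk ⊢
          omega
      _ = _ := by
          rw [Finset.sum_union]
          · simp [h0, h1]
          · rw [Finset.disjoint_left]
            intro k hk hk'
            simp only [Finset.mem_insert, Finset.mem_singleton, Finset.mem_Icc] at hk hk'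
            omega
  refine (hsplit (fun k => l ^ k / k.factorial * |∫ ω, (b * Z ω) ^ k ∂μ|) (by simp)
    (by simp [integral_const_mul, hmean]) fun k => by positivity).trans ?_
  refine add_le_add_right (Finset.sum_le_sum fun k _ => ?_) _
  simp_rw [mul_pow]
  rw [integral_const_mul, abs_mul, abs_pow]
  have : |∫ ω, Z ω ^ k ∂μ| ≤ ∫ ω, |Z ω| ^ k ∂μ := by
    simpa only [abs_pow] using abs_integral_le_integral_abs (f := fun ω => Z ω ^ k) (μ := μ)
  calc l ^ k / k.factorial * (|b| ^ k * |∫ ω, Z ω ^ k ∂μ|)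
      ≤ l ^ k / k.factorial * (|b| ^ k * ∫ ω, |Z ω| ^ k ∂μ) := by gcongr
    _ = _ := by ring

/-- Any partial sum of the exponential series is dominated pointwise by `exp (u |Z|)`, hence by `C *
exp (|Z| ^ α)`, whose integral is at most `2 C`. -/
theorem sum_integral_abs_pow_le [IsProbabilityMeasure μ] {α : ℝ} (hα : 0 < α) {Z : Ω → ℝ}
    (hZ : Measurable Z) (hint : Integrable (fun ω => Real.exp (|Z ω| ^ α)) μ)
    (h2 : ∫ ω, Real.exp (|Z ω| ^ α) ∂μ ≤ 2) {u C : ℝ} (hu : 0 ≤ u) (hC : 0 ≤ C)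
    (h : ∀ x : ℝ, 0 ≤ x → Real.exp (u * x) ≤ C * Real.exp (x ^ α)) (s : Finset ℕ) :
    ∑ k ∈ s, u ^ k / k.factorial * ∫ ω, |Z ω| ^ k ∂μ ≤ 2 * C := by
  have hi : ∀ k : ℕ, Integrable (fun ω => |Z ω| ^ k) μ := fun k => by
    rcases eq_or_ne k 0 with rfl | hk
    · simp
    · exact integrable_abs_pow_of_exp hα hZ hint hk
  simp_rw [← integral_const_mul]
  rw [← integral_finsetSum _ fun k _ => (hi k).const_mul _]
  calc ∫ ω, ∑ k ∈ s, u ^ k / k.factorial * |Z ω| ^ k ∂μ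
      ≤ ∫ ω, C * Real.exp (|Z ω| ^ α) ∂μ := by
        refine integral_mono (integrable_finsetSum _ fun k _ => (hi k).const_mul _)
          (hint.const_mul _) fun ω => le_trans ?_ (h _ (abs_nonneg _))
        have hexp := NormedSpace.expSeries_div_hasSum_exp (u * |Z ω|)
        rw [← Real.exp_eq_exp_ℝ] at hexp
        refine le_trans (le_of_eq ?_) (sum_le_hasSum s (fun k _ => by positivity) hexp)
        exact Finset.sum_congr rfl fun k _ => by rw [mul_pow]; ring
    _ ≤ 2 * C := by
        rw [integral_const_mul, mul_comm]
        gcongr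

/-! ### The series of a single summand -/

/-- Since `l |b| ≤ 1`, a factor `(l |b|) ^ 2` can be pulled out of every term of order at least two;
what is left is the series at `u = 1`, controlled by `x ≤ 1 + x ^ α`. -/
theorem momentSeries_le_of_one_le [IsProbabilityMeasure μ] {α : ℝ} (hα : 1 ≤ α) {Z : Ω → ℝ}
    (hZ : Measurable Z) (hint : Integrable (fun ω => Real.exp (|Z ω| ^ α)) μ)
    (h2 : ∫ ω, Real.exp (|Z ω| ^ α) ∂μ ≤ 2) (hmean : ∫ ω, Z ω ∂μ = 0) {l b : ℝ} (hl : 0 ≤ l)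
    (hb : l * |b| ≤ 1) (N : ℕ) :
    momentSeries μ l N (fun ω => b * Z ω) ≤ Real.exp (2 * Real.exp 1 * (l * |b|) ^ 2) := by
  have hu : 0 ≤ l * |b| := by positivity
  refine (momentSeries_const_mul_le_of_mean_zero hl b hmean).trans
    (le_trans ?_ (Real.add_one_le_exp _))
  rw [add_comm]
  gcongr
  have h1 := sum_integral_abs_pow_le (μ := μ) (zero_lt_one.trans_le hα) hZ hint h2 zero_le_one
    (Real.exp_pos 1).le (fun x hx => ?_) (Finset.Icc 2 N)
  · calc ∑ k ∈ Finset.Icc 2 N, (l * |b|) ^ k / k.factorial * ∫ ω, |Z ω| ^ k ∂μ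
        ≤ ∑ k ∈ Finset.Icc 2 N, (l * |b|) ^ 2 *
            (1 ^ k / k.factorial * ∫ ω, |Z ω| ^ k ∂μ) := by
          refine Finset.sum_le_sum fun k hk => ?_
          have hp : (l * |b|) ^ k ≤ (l * |b|) ^ 2 :=
            pow_le_pow_of_le_one hu hb (Finset.mem_Icc.mp hk).1
          have h0 : 0 ≤ ∫ ω, |Z ω| ^ k ∂μ := integral_nonneg fun ω => by positivity
          rw [one_pow, ← mul_assoc, mul_one_div]
          gcongr
      _ ≤ 2 * Real.exp 1 * (l * |b|) ^ 2 := by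
          rw [← Finset.mul_sum, mul_comm]
          gcongr
  · rw [← Real.exp_add, one_mul, Real.exp_le_exp]
    rcases le_total x 1 with h | h
    · have := Real.rpow_nonneg hx α
      linarith
    · have := Real.self_le_rpow_of_one_le h hα
      linarith

/-- Young's inequality gives `u x ≤ x ^ α + u ^ β`, so the series is at most `2 exp (u ^ β)` with `u
= l |b|`. As `u ≥ 1`, the factor `2` is absorbed by a second `exp (u ^ β)`. -/
theorem momentSeries_le_of_holderConjugate [IsProbabilityMeasure μ] {α β : ℝ}
    (hαβ : α.HolderConjugate β) {Z : Ω → ℝ}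
    (hZ : Measurable Z) (hint : Integrable (fun ω => Real.exp (|Z ω| ^ α)) μ)
    (h2 : ∫ ω, Real.exp (|Z ω| ^ α) ∂μ ≤ 2) {l b : ℝ} (hl : 0 ≤ l)
    (hb : 1 ≤ l * |b|) (N : ℕ) :
    momentSeries μ l N (fun ω => b * Z ω) ≤ Real.exp (2 * (l * |b|) ^ β) := by
  have hu : 0 ≤ l * |b| := by positivity
  refine (momentSeries_const_mul_le hl N b Z).trans ?_
  refine (sum_integral_abs_pow_le hαβ.pos hZ hint h2 hu
    (Real.exp_pos ((l * |b|) ^ β)).le (fun x hx => ?_) _).trans ?_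
  · rw [← Real.exp_add, Real.exp_le_exp]
    have hy := Real.young_inequality_of_nonneg hx hu hαβ
    have h3 : x ^ α / α ≤ x ^ α := div_le_self (by positivity) hαβ.lt.le
    have h4 : (l * |b|) ^ β / β ≤ (l * |b|) ^ β := div_le_self (by positivity) hαβ.symm.lt.le
    linarith
  · have h1 : 1 ≤ (l * |b|) ^ β := Real.one_le_rpow hb hαβ.symm.pos.le
    have h5 : 2 ≤ Real.exp ((l * |b|) ^ β) := by
      have := Real.add_one_le_exp ((l * |b|) ^ β)
      linarith
    rw [two_mul ((l * |b|) ^ β), Real.exp_add]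
    gcongr

theorem sum_Icc_two_geometric_le (N : ℕ) :
    ∑ k ∈ Finset.Icc 2 N, (1 / 2 : ℝ) ^ (k - 2) ≤ 2 := by
  rw [← Finset.Ico_add_one_right_eq_Icc, Finset.sum_Ico_eq_sum_range]
  simp only [add_tsub_cancel_left]
  exact sum_le_hasSum _ (fun k _ => by positivity) hasSum_geometric_two

theorem sq_le_four_mul_exp (k : ℕ) (hk : 2 ≤ k) : (k : ℝ) ^ 2 ≤ 4 * Real.exp 1 ^ (k - 2) := by
  have h1 : (k : ℝ) / 2 ≤ Real.exp (k / 2 - 1) := by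
    have := Real.add_one_le_exp ((k : ℝ) / 2 - 1)
    linarith
  have h2 : Real.exp 1 ^ (k - 2) = Real.exp (k / 2 - 1) ^ 2 := by
    rw [← Real.exp_nat_mul, ← Real.exp_nat_mul, Nat.cast_sub hk]
    push_cast
    ring_nf
  rw [h2]
  have := pow_le_pow_left₀ (by positivity) h1 2
  linarith

/-- Two of the `k` factors are kept to produce `w ^ 2`, the other `k - 2` are each at most `1/2 / e
^ γ`. The factor `e` in the hypothesis is there so that `e ^ (γ (k - 2))` absorbs the surplus `k ^
(2 γ)`, up to `4 ^ γ`. -/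
theorem pow_mul_rpow_le {w γ : ℝ} (hw : 0 ≤ w) (hγ : 0 ≤ γ) {N : ℕ}
    (h : 2 * w * (Real.exp 1 * N) ^ γ ≤ 1) {k : ℕ} (hk : k ∈ Finset.Icc 2 N) :
    (w * (k : ℝ) ^ γ) ^ k ≤ 4 ^ γ * w ^ 2 * (1 / 2) ^ (k - 2) := by
  obtain ⟨hk2, hkN⟩ := Finset.mem_Icc.mp hk
  have h1 : w * (k : ℝ) ^ γ ≤ 1 / 2 / Real.exp 1 ^ γ := by
    rw [le_div_iff₀ (by positivity), mul_assoc, ← Real.mul_rpow (by positivity) (by positivity)]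
    have : ((k : ℝ) * Real.exp 1) ^ γ ≤ (Real.exp 1 * N) ^ γ := by
      rw [mul_comm]
      gcongr
    nlinarith
  calc (w * (k : ℝ) ^ γ) ^ k = (w * (k : ℝ) ^ γ) ^ 2 * (w * (k : ℝ) ^ γ) ^ (k - 2) := by
        rw [← pow_add, Nat.add_sub_cancel' hk2]
    _ ≤ (w * (k : ℝ) ^ γ) ^ 2 * (1 / 2 / Real.exp 1 ^ γ) ^ (k - 2) := by gcongr
    _ = w ^ 2 * (1 / 2) ^ (k - 2) * (((k : ℝ) ^ 2) ^ γ / (Real.exp 1 ^ (k - 2)) ^ γ) := by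
        rw [mul_pow, div_pow (1 / 2 : ℝ), ← Real.rpow_pow_comm (by positivity),
          ← Real.rpow_pow_comm (by positivity)]
        ring
    _ ≤ w ^ 2 * (1 / 2) ^ (k - 2) * 4 ^ γ := by
        gcongr
        rw [div_le_iff₀ (by positivity), ← Real.mul_rpow (by positivity) (by positivity)]
        exact Real.rpow_le_rpow (by positivity) (sq_le_four_mul_exp k hk2) hγ
    _ = _ := by ring

/-- From `1 / k! ≤ (e / k) ^ k`: the factorial cancels one power of `k` out of the moment growth `k
^ (k / α)`, leaving `k ^ (1 / α - 1)` per factor. -/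
theorem pow_div_factorial_mul_le {α u : ℝ} (hα : 0 < α) (hu : 0 ≤ u) {k : ℕ} (hk : k ≠ 0) :
    u ^ k / k.factorial * (k / (α * Real.exp 1)) ^ (k / α) ≤
      (u * (Real.exp 1 / (α * Real.exp 1) ^ (1 / α)) * (k : ℝ) ^ (1 / α - 1)) ^ k := by
  have hk' : (0 : ℝ) < k := by positivity
  have h1 : 1 / (k.factorial : ℝ) ≤ (Real.exp 1 / k) ^ k := by
    have := Real.pow_div_factorial_le_exp _ hk'.le k
    rw [div_pow, ← Real.exp_nat_mul, mul_one, le_div_iff₀ (by positivity)]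
    rwa [one_div_mul_eq_div]
  have h2 : ((k : ℝ) / (α * Real.exp 1)) ^ (k / α) =
      ((k : ℝ) ^ (1 / α - 1) * k / (α * Real.exp 1) ^ (1 / α)) ^ k := by
    rw [← Real.rpow_add_one hk'.ne', sub_add_cancel, ← Real.div_rpow hk'.le (by positivity),
      ← Real.rpow_mul_natCast (by positivity)]
    congr 1
    ring
  calc u ^ k / k.factorial * (k / (α * Real.exp 1)) ^ (k / α)
      = u ^ k * (1 / k.factorial) * (k / (α * Real.exp 1)) ^ (k / α) := by ring
    _ ≤ u ^ k * (Real.exp 1 / k) ^ k * (k / (α * Real.exp 1)) ^ (k / α) := by gcongr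
    _ = _ := by
        rw [h2, ← mul_pow, ← mul_pow]
        congr 1
        field_simp

theorem momentSeries_le_of_le_one [IsProbabilityMeasure μ] {α : ℝ} (hα : 0 < α) (hα1 : α ≤ 1)
    {Z : Ω → ℝ} (hZ : Measurable Z) (hint : Integrable (fun ω => Real.exp (|Z ω| ^ α)) μ)
    (h2 : ∫ ω, Real.exp (|Z ω| ^ α) ∂μ ≤ 2) (hmean : ∫ ω, Z ω ∂μ = 0) {l b : ℝ} (hl : 0 ≤ l)
    {N : ℕ} (hb : 2 * (l * |b| * (Real.exp 1 / (α * Real.exp 1) ^ (1 / α))) *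
      (Real.exp 1 * N) ^ (1 / α - 1) ≤ 1) :
    momentSeries μ l N (fun ω => b * Z ω) ≤
      Real.exp ((2 ^ (1 / α) * (Real.exp 1 / (α * Real.exp 1) ^ (1 / α)) * (l * |b|)) ^ 2) := by
  set c := Real.exp 1 / (α * Real.exp 1) ^ (1 / α) with hc
  have hγ : 0 ≤ 1 / α - 1 := by
    rw [sub_nonneg, le_div_iff₀ hα]
    linarith
  have hu : 0 ≤ l * |b| := by positivity
  have hw : 0 ≤ l * |b| * c := by positivity
  refine (momentSeries_const_mul_le_of_mean_zero hl b hmean).trans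
    (le_trans ?_ (Real.add_one_le_exp _))
  rw [add_comm]
  gcongr
  calc ∑ k ∈ Finset.Icc 2 N, (l * |b|) ^ k / k.factorial * ∫ ω, |Z ω| ^ k ∂μ
      ≤ ∑ k ∈ Finset.Icc 2 N, 2 * (4 ^ (1 / α - 1) * (l * |b| * c) ^ 2) *
          (1 / 2) ^ (k - 2) := by
        refine Finset.sum_le_sum fun k hk => ?_
        have hk0 : k ≠ 0 := by
          have := (Finset.mem_Icc.mp hk).1
          omega
        calc (l * |b|) ^ k / k.factorial * ∫ ω, |Z ω| ^ k ∂μ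
            ≤ (l * |b|) ^ k / k.factorial * (2 * (k / (α * Real.exp 1)) ^ (k / α)) := by
              gcongr
              exact integral_abs_pow_le hα hZ hint h2 hk0
          _ = 2 * ((l * |b|) ^ k / k.factorial * (k / (α * Real.exp 1)) ^ (k / α)) := by ring
          _ ≤ 2 * (4 ^ (1 / α - 1) * (l * |b| * c) ^ 2 * (1 / 2) ^ (k - 2)) := by
              refine mul_le_mul_of_nonneg_left ?_ zero_le_two
              exact (pow_div_factorial_mul_le hα hu hk0).trans (pow_mul_rpow_le hw hγ hb hk)
          _ = _ := by ring
    _ ≤ 2 * (4 ^ (1 / α - 1) * (l * |b| * c) ^ 2) * 2 := by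
        rw [← Finset.mul_sum]
        gcongr
        exact sum_Icc_two_geometric_le N
    _ = _ := by
        have h4 : (4 : ℝ) ^ (1 / α) = (2 ^ (1 / α)) ^ 2 := by
          rw [Real.rpow_pow_comm (by norm_num)]
          norm_num
        rw [Real.rpow_sub_one (by norm_num), h4]
        ring

/-! ### Tail bounds for the weighted sum -/

section Tail

/-- A sequence of independent centred random variables with `𝔼[exp(|Z i| ^ α)] ≤ 2`. -/
structure IsNormalizedFamily {n : ℕ} (α : ℝ) (Z : Fin n → Ω → ℝ) (μ : Measure Ω) : Prop where
  measurable : ∀ i, Measurable (Z i)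
  indep : iIndepFun Z μ
  mean_zero : ∀ i, ∫ ω, Z i ω ∂μ = 0
  integrable_exp : ∀ i, Integrable (fun ω => Real.exp (|Z i ω| ^ α)) μ
  integral_exp_le : ∀ i, ∫ ω, Real.exp (|Z i ω| ^ α) ∂μ ≤ 2

variable {n : ℕ} {α : ℝ} {Z : Fin n → Ω → ℝ}

theorem IsNormalizedFamily.tail_of_momentSeries_le [IsProbabilityMeasure μ]
    (hZ : IsNormalizedFamily α Z μ) (hα : 0 < α) (b : Fin n → ℝ) {l : ℝ} (hl : 0 < l) {N : ℕ}
    (hN : Even N) (hN0 : N ≠ 0) {g : Fin n → ℝ}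
    (h : ∀ i, momentSeries μ l N (fun ω => b i * Z i ω) ≤ Real.exp (g i)) (hg : ∑ i, g i ≤ N) :
    μ.real {ω | Real.exp 2 * N / l ≤ |∑ i, b i * Z i ω|} ≤ Real.exp (-N) := by
  have hL : ∀ i, ∀ k : ℕ, MemLp (fun ω => b i * Z i ω) k μ := fun i k =>
    (memLp_of_exp hα (hZ.measurable i) (hZ.integrable_exp i) k).const_mul _
  have hind : iIndepFun (fun i ω => b i * Z i ω) μ :=
    hZ.indep.comp (fun i x => b i * x) fun i => by fun_prop
  have hsum := momentSeries_sum_le hl.le N (fun i => (hZ.measurable i).const_mul (b i)) hL hind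
    Finset.univ
  have hprod : ∏ i, momentSeries μ l N (fun ω => b i * Z i ω) ≤ Real.exp N := by
    refine (Finset.prod_le_prod (fun i _ => momentSeries_nonneg hl.le _ _) fun i _ => h i).trans ?_
    rw [← Real.exp_sum]
    exact Real.exp_le_exp.mpr hg
  have := measureReal_ge_le_of_momentSeries_le hl hN hN0
    (fun k => memLp_finsetSum' _ fun i _ => hL i k) (hsum.trans hprod)
  simpa only [Finset.sum_apply] using this

theorem sum_mul_abs_sq_le {b : Fin n → ℝ} {B w l r : ℝ} (hB : ∑ i, b i ^ 2 ≤ B ^ 2)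
    (h : w * (l * B) ^ 2 ≤ r) (hw : 0 ≤ w) : ∑ i, w * (l * |b i|) ^ 2 ≤ r := by
  refine le_trans ?_ h
  simp_rw [mul_pow, sq_abs, ← mul_assoc]
  rw [← Finset.mul_sum]
  gcongr

theorem inv_add_mul_le_one_left {p q : ℝ} (hp : 0 < p) (hq : 0 ≤ q) : (p + q)⁻¹ * p ≤ 1 := by
  rw [inv_mul_le_one₀ (by positivity)]
  linarith

theorem inv_add_mul_le_one_right {p q : ℝ} (hp : 0 < p) (hq : 0 ≤ q) : (p + q)⁻¹ * q ≤ 1 := by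
  rw [inv_mul_le_one₀ (by positivity)]
  linarith

theorem IsNormalizedFamily.tail_of_le_one [IsProbabilityMeasure μ]
    (hZ : IsNormalizedFamily α Z μ) (hα : 0 < α) (hα1 : α ≤ 1) {b : Fin n → ℝ} {B B' : ℝ}
    (hB0 : 0 < B) (hB0' : 0 ≤ B') (hB : ∑ i, b i ^ 2 ≤ B ^ 2) (hB' : ∀ i, |b i| ≤ B') {N : ℕ}
    (hN : Even N) (hN0 : N ≠ 0) :
    μ.real {ω | Real.exp 2 * (Real.exp 1 / (α * Real.exp 1) ^ (1 / α)) *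
        (2 ^ (1 / α) * B * √N + 2 * (Real.exp 1 * N) ^ (1 / α - 1) * N * B') ≤
        |∑ i, b i * Z i ω|} ≤ Real.exp (-N) := by
  set c := Real.exp 1 / (α * Real.exp 1) ^ (1 / α) with hc
  have hc0 : 0 < c := by positivity
  have hNpos : (0 : ℝ) < N := by positivity
  set D := (Real.exp 1 * N) ^ (1 / α - 1) with hD
  have hD0 : 0 < D := by positivity
  -- With `l = (p + q)⁻¹`, `l p ≤ 1` keeps the sum of the Gaussian exponents below `N`, and `l q ≤
  -- 1` is the geometric-decay condition for every `|b i| ≤ B'`.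
  set p := 2 ^ (1 / α) * c * B / √N with hp
  set q := 2 * c * D * B' with hq
  have hp0 : 0 < p := by positivity
  have hq0 : 0 ≤ q := by positivity
  have hl : 0 < (p + q)⁻¹ := by positivity
  have h1 := inv_add_mul_le_one_left hp0 hq0
  have h2 := inv_add_mul_le_one_right hp0 hq0
  have key := hZ.tail_of_momentSeries_le hα b hl hN hN0
    (g := fun i => (2 ^ (1 / α) * c) ^ 2 * ((p + q)⁻¹ * |b i|) ^ 2) (fun i => ?_) ?_
  · convert key using 5
    rw [div_inv_eq_mul, hp, hq]
    linear_combination -(Real.exp 2 * (2 ^ (1 / α) * c * B)) * Real.div_sqrt (x := (N : ℝ))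
  · rw [← mul_pow]
    refine momentSeries_le_of_le_one hα hα1 (hZ.measurable i) (hZ.integrable_exp i)
      (hZ.integral_exp_le i) (hZ.mean_zero i) hl.le (le_trans ?_ h2)
    calc 2 * ((p + q)⁻¹ * |b i| * c) * D = (p + q)⁻¹ * (2 * c * D * |b i|) := by ring
      _ ≤ (p + q)⁻¹ * q := by
        rw [hq]
        gcongr
        exact hB' i
  · refine sum_mul_abs_sq_le hB ?_ (by positivity)
    calc (2 ^ (1 / α) * c) ^ 2 * ((p + q)⁻¹ * B) ^ 2 = ((p + q)⁻¹ * p) ^ 2 * (√N) ^ 2 := by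
          rw [hp]
          field_simp
      _ ≤ 1 ^ 2 * (√N) ^ 2 := by gcongr
      _ = N := by rw [Real.sq_sqrt hNpos.le]; ring

/-- Common frame for `α = 1` and `α > 1`. The budget `N` in the exponent is split evenly: the
Gaussian part takes `N / 2`, which fixes the `√(4 e)` in `p`, and the remainder `g` takes the other
half. -/
theorem IsNormalizedFamily.tail_of_one_le_of_momentSeries_le [IsProbabilityMeasure μ]
    (hZ : IsNormalizedFamily α Z μ) (hα : 0 < α) {b : Fin n → ℝ} {B q : ℝ}
    (hB0 : 0 < B) (hB : ∑ i, b i ^ 2 ≤ B ^ 2) (hq0 : 0 ≤ q) {N : ℕ} (hN : Even N) (hN0 : N ≠ 0)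
    (h : ∀ l : ℝ, 0 ≤ l → l * q ≤ 1 → ∃ g : Fin n → ℝ, ∑ i, g i ≤ N / 2 ∧
      ∀ i, momentSeries μ l N (fun ω => b i * Z i ω) ≤
        Real.exp (2 * Real.exp 1 * (l * |b i|) ^ 2 + g i)) :
    μ.real {ω | Real.exp 2 * (√(4 * Real.exp 1) * B * √N + N * q) ≤
      |∑ i, b i * Z i ω|} ≤ Real.exp (-N) := by
  have hNpos : (0 : ℝ) < N := by positivity
  set p := √(4 * Real.exp 1) * B / √N with hp
  have hp0 : 0 < p := by positivity
  have hl : 0 < (p + q)⁻¹ := by positivity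
  have h1 := inv_add_mul_le_one_left hp0 hq0
  have h2 := inv_add_mul_le_one_right hp0 hq0
  obtain ⟨g, hgs, hg⟩ := h _ hl.le h2
  have key := hZ.tail_of_momentSeries_le hα b hl hN hN0 hg ?_
  · convert key using 5
    rw [div_inv_eq_mul, hp]
    linear_combination -(Real.exp 2 * (√(4 * Real.exp 1) * B)) * Real.div_sqrt (x := (N : ℝ))
  · rw [Finset.sum_add_distrib]
    have : ∑ i, 2 * Real.exp 1 * ((p + q)⁻¹ * |b i|) ^ 2 ≤ (N : ℝ) / 2 := by
      refine sum_mul_abs_sq_le hB ?_ (by positivity)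
      calc 2 * Real.exp 1 * ((p + q)⁻¹ * B) ^ 2 = ((p + q)⁻¹ * p) ^ 2 * ((√N) ^ 2 / 2) := by
            have h4 : √(4 * Real.exp 1) ^ 2 = 4 * Real.exp 1 := Real.sq_sqrt (by positivity)
            rw [hp, mul_pow _ (_ / _), div_pow, mul_pow (√_), h4]
            field_simp
            ring
        _ ≤ 1 ^ 2 * ((√N) ^ 2 / 2) := by gcongr
        _ = N / 2 := by rw [Real.sq_sqrt hNpos.le]; ring
    linarith

theorem IsNormalizedFamily.tail_of_one [IsProbabilityMeasure μ]
    (hZ : IsNormalizedFamily 1 Z μ) {b : Fin n → ℝ} {B B' : ℝ}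
    (hB0 : 0 < B) (hB0' : 0 ≤ B') (hB : ∑ i, b i ^ 2 ≤ B ^ 2) (hB' : ∀ i, |b i| ≤ B') {N : ℕ}
    (hN : Even N) (hN0 : N ≠ 0) :
    μ.real {ω | Real.exp 2 * (√(4 * Real.exp 1) * B * √N + N * B') ≤
      |∑ i, b i * Z i ω|} ≤ Real.exp (-N) := by
  refine hZ.tail_of_one_le_of_momentSeries_le one_pos hB0 hB hB0' hN hN0 fun l hl hlq =>
    ⟨fun _ => 0, by simp; positivity, fun i => ?_⟩
  rw [add_zero]
  exact momentSeries_le_of_one_le le_rfl (hZ.measurable i) (hZ.integrable_exp i)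
    (hZ.integral_exp_le i) (hZ.mean_zero i) hl
    ((mul_le_mul_of_nonneg_left (hB' i) hl).trans hlq) N

theorem IsNormalizedFamily.tail_of_holderConjugate [IsProbabilityMeasure μ] {β : ℝ}
    (hZ : IsNormalizedFamily α Z μ) (hαβ : α.HolderConjugate β) {b : Fin n → ℝ} {B B' : ℝ}
    (hB0 : 0 < B) (hB0' : 0 ≤ B') (hB : ∑ i, b i ^ 2 ≤ B ^ 2)
    (hB' : ∑ i, |b i| ^ β ≤ B' ^ β) {N : ℕ} (hN : Even N) (hN0 : N ≠ 0) :
    μ.real {ω | Real.exp 2 * (√(4 * Real.exp 1) * B * √N +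
        N * (B' * ((N : ℝ) / 4) ^ (1 / α - 1))) ≤
      |∑ i, b i * Z i ω|} ≤ Real.exp (-N) := by
  have hNpos : (0 : ℝ) < N := by positivity
  have hβ := hαβ.symm.pos
  refine hZ.tail_of_one_le_of_momentSeries_le hαβ.pos hB0 hB (by positivity) hN hN0
    fun l hl hlq => ⟨fun i => 2 * (l * |b i|) ^ β, ?_, fun i => ?_⟩
  -- The power `(N / 4) ^ (1 / α - 1) = (N / 4) ^ (-1 / β)` is chosen so that `l q ≤ 1` reads `(l
  -- B') ^ β ≤ N / 4`.
  · have hexp : (1 / α - 1) * β = -1 := by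
      have h := hαβ.inv_add_inv_eq_one
      have : 1 / α - 1 = -β⁻¹ := by
        rw [one_div]
        linarith
      rw [this]
      field_simp
    have h1 : (l * B') ^ β ≤ N / 4 := by
      have h2 : (l * (B' * ((N : ℝ) / 4) ^ (1 / α - 1))) ^ β ≤ 1 :=
        Real.rpow_le_one (by positivity) hlq hβ.le
      rw [← mul_assoc, Real.mul_rpow (by positivity) (by positivity),
        ← Real.rpow_mul (by positivity), hexp, Real.rpow_neg_one,
        mul_inv_le_iff₀ (by positivity), one_mul] at h2
      exact h2
    calc ∑ i, 2 * (l * |b i|) ^ β = 2 * (l ^ β * ∑ i, |b i| ^ β) := by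
          rw [Finset.mul_sum, Finset.mul_sum]
          exact Finset.sum_congr rfl fun i _ => by rw [Real.mul_rpow hl (abs_nonneg _)]
      _ ≤ 2 * (l ^ β * B' ^ β) := by gcongr
      _ = 2 * (l * B') ^ β := by rw [Real.mul_rpow hl hB0']
      _ ≤ N / 2 := by linarith
  · have hu : 0 ≤ l * |b i| := by positivity
    -- Each index uses only one of the two bounds; adding both exponents avoids splitting the sum by
    -- the size of `l |b i|`.
    rcases le_total (l * |b i|) 1 with h | h
    · refine (momentSeries_le_of_one_le hαβ.lt.le (hZ.measurable i) (hZ.integrable_exp i)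
        (hZ.integral_exp_le i) (hZ.mean_zero i) hl h N).trans (Real.exp_le_exp.mpr ?_)
      have : 0 ≤ 2 * (l * |b i|) ^ β := by positivity
      linarith
    · refine (momentSeries_le_of_holderConjugate hαβ (hZ.measurable i) (hZ.integrable_exp i)
        (hZ.integral_exp_le i) hl h N).trans (Real.exp_le_exp.mpr ?_)
      have : 0 ≤ 2 * Real.exp 1 * (l * |b i|) ^ 2 := by positivity
      linarith

end Tail

/-! ### From tail bounds to the GBO norm -/

theorem gboInv_monotoneOn {α L : ℝ} (hα : 0 < α) (hL : 0 ≤ L) :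
    MonotoneOn (gboInv α L) (Set.Ici 0) := by
  intro s hs t _ hst
  have hs' : (0 : ℝ) ≤ s := hs
  have h0 : 0 ≤ Real.log (1 + s) := Real.log_nonneg (by linarith)
  have h1 : Real.log (1 + s) ≤ Real.log (1 + t) := Real.log_le_log (by linarith) (by linarith)
  unfold gboInv
  gcongr

theorem gboPsi_nonneg {α L : ℝ} (hα : 0 < α) (hL : 0 ≤ L) {x : ℝ} (hx : 0 ≤ x) :
    0 ≤ gboPsi α L x :=
  (gboInv_bijOn hα hL).surjOn.mapsTo_invFunOn hx

theorem gboPsi_monotoneOn {α L : ℝ} (hα : 0 < α) (hL : 0 ≤ L) :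
    MonotoneOn (gboPsi α L) (Set.Ici 0) := by
  intro x hx y hy hxy
  by_contra! h
  have h1 := gboInv_monotoneOn hα hL (gboPsi_nonneg hα hL hy) (gboPsi_nonneg hα hL hx) h.le
  rw [gboInv_gboPsi hα hL hx, gboInv_gboPsi hα hL hy] at h1
  rw [le_antisymm hxy h1] at h
  exact lt_irrefl _ h

theorem gboPsi_zero {α L : ℝ} (hα : 0 < α) (hL : 0 ≤ L) : gboPsi α L 0 = 0 := by
  have h : gboInv α L 0 = 0 := by
    have : (1 / α) ≠ 0 := by positivity
    simp only [gboInv, add_zero, Real.log_one, Real.sqrt_zero, Real.zero_rpow this, mul_zero]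
  simpa only [h] using gboPsi_gboInv hα hL le_rfl

/-- The integral equals `e² / 8`. With `c > 1` in place of `9` it would be `e² / (c - 1)`, so `9` is
the least integer that works. -/
theorem lintegral_exp_log_le :
    ∫⁻ t in Set.Ioi (0 : ℝ), ENNReal.ofReal (Real.exp (2 - 9 * Real.log (1 + t))) ≤ 1 := by
  have hderiv : ∀ x ∈ Set.Ici (0 : ℝ), HasDerivAt
      (fun t => -(1 / 8) * Real.exp (2 - 8 * Real.log (1 + t)))
      (Real.exp (2 - 9 * Real.log (1 + x))) x := by
    intro x hx
    have hx' : (0 : ℝ) < 1 + x := by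
      have : (0 : ℝ) ≤ x := hx
      linarith
    have h := (((((hasDerivAt_id x).const_add 1).log hx'.ne').const_mul 8).const_sub 2).exp.const_mul
      (-(1 / 8) : ℝ)
    refine h.congr_deriv ?_
    have h9 : Real.exp (2 - 9 * Real.log (1 + x)) =
        Real.exp (2 - 8 * Real.log (1 + x)) * (1 + x)⁻¹ := by
      rw [← Real.exp_log (inv_pos.mpr hx'), ← Real.exp_add, Real.log_inv]
      ring_nf
    rw [h9]
    simp only [id]
    ring
  have htend : Filter.Tendsto (fun t : ℝ => -(1 / 8) * Real.exp (2 - 8 * Real.log (1 + t)))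
      Filter.atTop (nhds 0) := by
    rw [← mul_zero (-(1 / 8) : ℝ)]
    refine (Real.tendsto_exp_atBot.comp ?_).const_mul _
    have h1 : Filter.Tendsto (fun t : ℝ => 8 * Real.log (1 + t)) Filter.atTop Filter.atTop :=
      (Real.tendsto_log_atTop.comp
        (Filter.tendsto_atTop_add_const_left _ 1 Filter.tendsto_id)).const_mul_atTop (by norm_num)
    exact Filter.tendsto_atBot_add_const_left _ 2 (Filter.tendsto_neg_atTop_atBot.comp h1)
  have hnn : ∀ x ∈ Set.Ioi (0 : ℝ), 0 ≤ Real.exp (2 - 9 * Real.log (1 + x)) :=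
    fun x _ => (Real.exp_pos _).le
  rw [← ofReal_integral_eq_lintegral_ofReal (integrableOn_Ioi_deriv_of_nonneg' hderiv hnn htend)
    (Filter.Eventually.of_forall fun x => (Real.exp_pos _).le),
    integral_Ioi_of_hasDerivAt_of_nonneg' hderiv hnn htend, ENNReal.ofReal_le_one]
  have h2 : Real.exp 2 = Real.exp 1 ^ 2 := by rw [← Real.exp_nat_mul]; norm_num
  have h1 := Real.exp_one_lt_d9
  have h0 := Real.exp_pos 1
  simp only [add_zero, Real.log_one, mul_zero, sub_zero, h2]
  nlinarith

/-- A tail bound `ℙ(η (√s + L s ^ (1/α)) ≤ |S|) ≤ e^{-N}` for even `N ≤ 9 s` gives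
`‖S‖_{Ψ_{α,L}} ≤ η`. -/
theorem orliczNorm_gboPsi_le_of_tail [IsProbabilityMeasure μ] {α L η : ℝ} (hα : 0 < α)
    (hL : 0 ≤ L) (hη : 0 < η) {S : Ω → ℝ} (hS : Measurable S)
    (h : ∀ s : ℝ, 0 ≤ s → ∀ N : ℕ, Even N → N ≠ 0 → (N : ℝ) ≤ 9 * s →
      μ.real {ω | η * (√s + L * s ^ (1 / α)) ≤ |S ω|} ≤ Real.exp (-N)) :
    orliczNorm (gboPsi α L) S μ ≤ ENNReal.ofReal η := by
  refine sInf_le ⟨η, hη, rfl, ?_⟩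
  have hdiv : ∀ ω, 0 ≤ |S ω| / η := fun ω => by positivity
  have hmeas : Measurable fun ω => gboPsi α L (|S ω| / η) := by
    -- `gboPsi` is monotone only on `[0, ∞)`, being defined through `Function.invFunOn`; clamping at
    -- `0` makes it globally monotone, hence measurable.
    have hmono : Monotone fun x => gboPsi α L (max x 0) := fun x y hxy =>
      gboPsi_monotoneOn hα hL (le_max_right x 0) (le_max_right y 0) (max_le_max_right 0 hxy)
    have hcomp : (fun ω => gboPsi α L (|S ω| / η)) =
        (fun x => gboPsi α L (max x 0)) ∘ fun ω => |S ω| / η := by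
      ext ω
      rw [Function.comp_apply, max_eq_left (hdiv ω)]
    rw [hcomp]
    exact hmono.measurable.comp (by fun_prop)
  rw [lintegral_eq_lintegral_meas_lt μ
    (Filter.Eventually.of_forall fun ω => gboPsi_nonneg hα hL (hdiv ω)) hmeas.aemeasurable]
  refine (setLIntegral_mono' measurableSet_Ioi fun t ht => ?_).trans lintegral_exp_log_le
  have ht0 : (0 : ℝ) ≤ t := le_of_lt ht
  have hs0 : 0 ≤ Real.log (1 + t) := Real.log_nonneg (by linarith)
  -- Below `2` no admissible nonzero even `N` need exist, but there the bound `exp (2 - 9 s)` is at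
  -- least `1`. Above, rounding down to an even integer loses less than `2`.
  rcases le_total (9 * Real.log (1 + t)) 2 with hs | hs
  · refine prob_le_one.trans ?_
    rw [ENNReal.one_le_ofReal]
    exact Real.one_le_exp (by linarith)
  · have hsub : {ω | t < gboPsi α L (|S ω| / η)} ⊆
        {ω | η * (√(Real.log (1 + t)) + L * Real.log (1 + t) ^ (1 / α)) ≤ |S ω|} := by
      intro ω hω
      rw [Set.mem_ofPred_eq] at hω ⊢
      by_contra! hlt
      have h1 : |S ω| / η ≤ gboInv α L t := by
        rw [div_le_iff₀ hη, mul_comm]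
        exact hlt.le
      have h2 := gboPsi_monotoneOn hα hL (hdiv ω) ((gboInv_bijOn hα hL).mapsTo ht0) h1
      rw [gboPsi_gboInv hα hL ht0] at h2
      exact absurd hω h2.not_gt
    refine (measure_mono hsub).trans ?_
    rw [← ofReal_measureReal]
    refine ENNReal.ofReal_le_ofReal ?_
    have hfl := Nat.floor_le (a := 9 * Real.log (1 + t) / 2) (by positivity)
    have hlf := Nat.lt_floor_add_one (9 * Real.log (1 + t) / 2)
    have hpos : 1 ≤ ⌊9 * Real.log (1 + t) / 2⌋₊ := Nat.le_floor (by push_cast; linarith)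
    refine (h _ hs0 (2 * ⌊9 * Real.log (1 + t) / 2⌋₊) (even_two_mul _) (by omega)
      (by push_cast; linarith)).trans (Real.exp_le_exp.mpr ?_)
    push_cast
    linarith

theorem orliczNorm_gboPsi_of_ae_eq_zero {α L : ℝ} (hα : 0 < α) (hL : 0 ≤ L) {S : Ω → ℝ}
    (hS : S =ᵐ[μ] 0) : orliczNorm (gboPsi α L) S μ = 0 := by
  rw [← nonpos_iff_eq_zero]
  refine ENNReal.le_of_forall_pos_le_add fun ε hε _ => ?_
  refine sInf_le ⟨ε, hε, by simp, ?_⟩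
  rw [lintegral_congr_ae (g := fun _ => 0)]
  · simp
  · filter_upwards [hS] with ω hω
    simp [hω, gboPsi_zero hα hL]

/-! ### Normalisation by the Orlicz norm -/

theorem psi_nonneg {α x : ℝ} (hx : 0 ≤ x) : 0 ≤ psi α x := by
  have := Real.one_le_exp (Real.rpow_nonneg hx α)
  unfold psi
  linarith

theorem lintegral_psi_le_one_of_orliczNorm_lt {α : ℝ} (hα : 0 < α) {X : Ω → ℝ} {η : ℝ}
    (h : orliczNorm (psi α) X μ < ENNReal.ofReal η) :
    ∫⁻ ω, ENNReal.ofReal (psi α (|X ω| / η)) ∂μ ≤ 1 := by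
  obtain ⟨_, ⟨η', hη', rfl, h1⟩, hlt⟩ := sInf_lt_iff.mp h
  refine (lintegral_mono fun ω => ENNReal.ofReal_le_ofReal ?_).trans h1
  have hle : η' ≤ η := ((ENNReal.ofReal_lt_ofReal_iff_of_nonneg hη'.le).mp hlt).le
  have hη : 0 < η := hη'.trans_le hle
  unfold psi
  gcongr

/-- The infimum is attained: Fatou's lemma along `K + 1 / (m + 1)`, which decreases to `K`. -/
theorem lintegral_psi_div_orliczNorm_le {α : ℝ} (hα : 0 < α) {X : Ω → ℝ} (hX : Measurable X)
    (hfin : orliczNorm (psi α) X μ < ∞) :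
    ∫⁻ ω, ENNReal.ofReal (psi α (|X ω| / (orliczNorm (psi α) X μ).toReal)) ∂μ ≤ 1 := by
  set K := (orliczNorm (psi α) X μ).toReal with hK
  -- For `K = 0` the quotient is `0` by convention and `psi α 0 = 0`.
  rcases (ENNReal.toReal_nonneg : 0 ≤ K).eq_or_lt with h0 | hpos
  · rw [show K = 0 from h0.symm]
    simp [psi, Real.zero_rpow hα.ne']
  have hlt : ∀ m : ℕ, orliczNorm (psi α) X μ < ENNReal.ofReal (K + 1 / (m + 1)) := fun m => by
    rw [← ENNReal.ofReal_toReal hfin.ne, ← hK]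
    exact (ENNReal.ofReal_lt_ofReal_iff (by positivity)).mpr (lt_add_of_pos_right _ (by positivity))
  have hmeas : ∀ m : ℕ, Measurable fun ω =>
      ENNReal.ofReal (psi α (|X ω| / (K + 1 / ((m : ℝ) + 1)))) := fun m => by
    unfold psi
    fun_prop
  have hlim : ∀ ω, Filter.Tendsto (fun m : ℕ =>
      ENNReal.ofReal (psi α (|X ω| / (K + 1 / ((m : ℝ) + 1))))) Filter.atTop
      (nhds (ENNReal.ofReal (psi α (|X ω| / K)))) := fun ω => by
    refine ENNReal.tendsto_ofReal ?_
    have h1 : Filter.Tendsto (fun m : ℕ => |X ω| / (K + 1 / ((m : ℝ) + 1))) Filter.atTop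
        (nhds (|X ω| / K)) := by
      refine Filter.Tendsto.div tendsto_const_nhds ?_ hpos.ne'
      simpa using tendsto_one_div_add_atTop_nhds_zero_nat.const_add K
    exact ((Real.continuous_exp.tendsto _).comp (h1.rpow_const (Or.inr hα.le))).sub_const 1
  calc ∫⁻ ω, ENNReal.ofReal (psi α (|X ω| / K)) ∂μ
      = ∫⁻ ω, Filter.liminf (fun m : ℕ =>
          ENNReal.ofReal (psi α (|X ω| / (K + 1 / ((m : ℝ) + 1))))) Filter.atTop ∂μ :=
        lintegral_congr fun ω => (hlim ω).liminf_eq.symm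
    _ ≤ Filter.liminf (fun m : ℕ => ∫⁻ ω,
          ENNReal.ofReal (psi α (|X ω| / (K + 1 / ((m : ℝ) + 1)))) ∂μ) Filter.atTop :=
        lintegral_liminf_le hmeas
    _ ≤ 1 := Filter.liminf_le_of_frequently_le'
        (Filter.Frequently.of_forall fun m => lintegral_psi_le_one_of_orliczNorm_lt hα (hlt m))

/-- From `y ≤ exp y - 1` with scale `η = ε ^ (1 / α)`, `𝔼[|X| ^ α] ≤ ε` for every `ε > 0`. -/
theorem ae_eq_zero_of_orliczNorm_psi_eq_zero {α : ℝ} (hα : 0 < α) {X : Ω → ℝ}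
    (hX : Measurable X) (h : orliczNorm (psi α) X μ = 0) : X =ᵐ[μ] 0 := by
  have hle : ∫⁻ ω, ENNReal.ofReal (|X ω| ^ α) ∂μ ≤ 0 := by
    refine ENNReal.le_of_forall_pos_le_add fun ε hε _ => ?_
    have hη : (0 : ℝ) < (ε : ℝ) ^ (1 / α) := Real.rpow_pos_of_pos hε _
    have h1 := lintegral_psi_le_one_of_orliczNorm_lt hα (X := X) (μ := μ)
      (η := (ε : ℝ) ^ (1 / α)) (by rw [h]; exact ENNReal.ofReal_pos.mpr hη)
    rw [zero_add]
    calc ∫⁻ ω, ENNReal.ofReal (|X ω| ^ α) ∂μ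
        ≤ ∫⁻ ω, ε * ENNReal.ofReal (psi α (|X ω| / (ε : ℝ) ^ (1 / α))) ∂μ := by
          refine lintegral_mono fun ω => ?_
          rw [← ENNReal.ofReal_coe_nnreal, ← ENNReal.ofReal_mul (NNReal.coe_nonneg ε)]
          refine ENNReal.ofReal_le_ofReal ?_
          have h2 : |X ω| ^ α = ε * (|X ω| / (ε : ℝ) ^ (1 / α)) ^ α := by
            rw [Real.div_rpow (abs_nonneg _) hη.le, ← Real.rpow_mul (NNReal.coe_nonneg ε),
              one_div_mul_cancel hα.ne', Real.rpow_one]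
            field_simp
          rw [h2]
          refine mul_le_mul_of_nonneg_left ?_ ε.2
          have := Real.add_one_le_exp ((|X ω| / (ε : ℝ) ^ (1 / α)) ^ α)
          unfold psi
          linarith
      _ ≤ ε * 1 := by
          rw [lintegral_const_mul']
          · gcongr
          · simp
      _ = ε := mul_one _
  rw [nonpos_iff_eq_zero, lintegral_eq_zero_iff (by fun_prop)] at hle
  filter_upwards [hle] with ω hω
  simp only [Pi.zero_apply, ENNReal.ofReal_eq_zero] at hω ⊢
  by_contra hne
  exact absurd hω (not_le.mpr (Real.rpow_pos_of_pos (abs_pos.mpr hne) α))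

theorem isNormalizedFamily_div_orliczNorm [IsProbabilityMeasure μ] {n : ℕ} {X : Fin n → Ω → ℝ}
    (hmeas : ∀ i, Measurable (X i)) (hindep : iIndepFun X μ)
    (hmean : ∀ i, ∫ ω, X i ω ∂μ = 0) {α : ℝ} (hα : 0 < α)
    (hfin : ∀ i, orliczNorm (psi α) (X i) μ < ∞) :
    IsNormalizedFamily α (fun i ω => X i ω / (orliczNorm (psi α) (X i) μ).toReal) μ := by
  have habs : ∀ i ω, |X i ω / (orliczNorm (psi α) (X i) μ).toReal| =
      |X i ω| / (orliczNorm (psi α) (X i) μ).toReal := fun i ω => by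
    rw [abs_div, abs_of_nonneg ENNReal.toReal_nonneg]
  have hnn : ∀ i, 0 ≤ᵐ[μ] fun ω => psi α (|X i ω| / (orliczNorm (psi α) (X i) μ).toReal) :=
    fun i => Filter.Eventually.of_forall fun ω => psi_nonneg (by positivity)
  have hm : ∀ i, Measurable fun ω => psi α (|X i ω| / (orliczNorm (psi α) (X i) μ).toReal) :=
    fun i => by
      have := hmeas i
      unfold psi
      fun_prop
  have hle := fun i => lintegral_psi_div_orliczNorm_le hα (hmeas i) (hfin i)
  have hint : ∀ i, Integrable
      (fun ω => psi α (|X i ω| / (orliczNorm (psi α) (X i) μ).toReal)) μ := fun i => by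
    refine ⟨(hm i).aestronglyMeasurable, ?_⟩
    rw [hasFiniteIntegral_iff_ofReal (hnn i)]
    exact (hle i).trans_lt ENNReal.one_lt_top
  have hexp : ∀ i ω, Real.exp (|X i ω / (orliczNorm (psi α) (X i) μ).toReal| ^ α) =
      psi α (|X i ω| / (orliczNorm (psi α) (X i) μ).toReal) + 1 := fun i ω => by
    rw [habs, psi, sub_add_cancel]
  refine ⟨fun i => (hmeas i).div_const _, ?_, fun i => ?_, fun i => ?_, fun i => ?_⟩
  · exact hindep.comp (fun i x => x / (orliczNorm (psi α) (X i) μ).toReal) fun i => by fun_prop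
  · rw [integral_div, hmean, zero_div]
  · simp_rw [hexp]
    exact (hint i).add (integrable_const 1)
  · simp_rw [hexp]
    rw [integral_add (hint i) (integrable_const 1),
      integral_eq_lintegral_of_nonneg_ae (hnn i) (hm i).aestronglyMeasurable]
    have := ENNReal.toReal_mono ENNReal.one_ne_top (hle i)
    simp only [ENNReal.toReal_one, integral_const, probReal_univ, smul_eq_mul, mul_one] at this ⊢
    linarith

theorem sum_mul_ae_eq_sum_div_orliczNorm {n : ℕ} {X : Fin n → Ω → ℝ}
    (hmeas : ∀ i, Measurable (X i)) {α : ℝ} (hα : 0 < α)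
    (hfin : ∀ i, orliczNorm (psi α) (X i) μ < ∞) {a b : Fin n → ℝ}
    (hb : ∀ i, b i = a i * (orliczNorm (psi α) (X i) μ).toReal) :
    (fun ω => ∑ i, a i * X i ω) =ᵐ[μ]
      fun ω => ∑ i, b i * (X i ω / (orliczNorm (psi α) (X i) μ).toReal) := by
  have h : ∀ i, ∀ᵐ ω ∂μ,
      a i * X i ω = b i * (X i ω / (orliczNorm (psi α) (X i) μ).toReal) := fun i => by
    by_cases h0 : (orliczNorm (psi α) (X i) μ).toReal = 0
    · have h1 := (ENNReal.toReal_eq_zero_iff _).mp h0 |>.resolve_right (hfin i).ne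
      filter_upwards [ae_eq_zero_of_orliczNorm_psi_eq_zero hα (hmeas i) h1] with ω hω
      simp [hω]
    · filter_upwards with ω
      rw [hb]
      field_simp
  filter_upwards [ae_all_iff.mpr h] with ω hω
  exact Finset.sum_congr rfl fun i _ => hω i

theorem orliczNorm_congr_ae {g : ℝ → ℝ} {X Y : Ω → ℝ} (h : X =ᵐ[μ] Y) :
    orliczNorm g X μ = orliczNorm g Y μ := by
  have : ∀ η : ℝ, ∫⁻ ω, ENNReal.ofReal (g (|X ω| / η)) ∂μ =
      ∫⁻ ω, ENNReal.ofReal (g (|Y ω| / η)) ∂μ := fun η => lintegral_congr_ae <| by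
    filter_upwards [h] with ω hω
    rw [hω]
  simp_rw [orliczNorm, this]

/-! ### Vector norms and comparison of constants -/

theorem sum_sq_eq_vecNorm_sq {n : ℕ} (b : Fin n → ℝ) : ∑ i, b i ^ 2 = vecNorm 2 b ^ 2 := by
  rw [vecNorm, EuclideanSpace.norm_sq_eq]
  simp

theorem vecNorm_nonneg {n : ℕ} {p : ℝ≥0∞} (hp : 1 ≤ p) (b : Fin n → ℝ) : 0 ≤ vecNorm p b := by
  have : Fact (1 ≤ p) := ⟨hp⟩
  exact norm_nonneg _

theorem abs_le_vecNorm_top {n : ℕ} (b : Fin n → ℝ) (i : Fin n) : |b i| ≤ vecNorm ∞ b :=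
  PiLp.norm_apply_le (WithLp.toLp ∞ b) i

theorem sum_abs_rpow_eq_vecNorm_rpow {n : ℕ} {p : ℝ≥0∞} (hp : 0 < p.toReal) (b : Fin n → ℝ) :
    ∑ i, |b i| ^ p.toReal = vecNorm p b ^ p.toReal := by
  rw [vecNorm, PiLp.norm_eq_sum hp, ← Real.rpow_mul (Finset.sum_nonneg fun i _ => by positivity),
    one_div_mul_cancel hp.ne', Real.rpow_one]
  simp

/-- The factors `(2 π) ^ (1/4)` and `e ^ (1/24)` are at least `1` and can be discarded. -/
theorem le_constC_of_lt_one {α : ℝ} (hα : 0 < α) (hα1 : α < 1) :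
    2 ^ (1 / α) * (√8 * Real.exp 3 * (Real.exp (2 / Real.exp 1) / α) ^ (1 / α)) ≤ constC α := by
  have h1 : (1 : ℝ) ≤ (2 * Real.pi) ^ ((1 : ℝ) / 4) :=
    Real.one_le_rpow (by linarith [Real.pi_gt_three]) (by norm_num)
  have h2 : (1 : ℝ) ≤ Real.exp (1 / 24) := Real.one_le_exp (by norm_num)
  rw [constC, if_pos hα1]
  refine mul_le_mul (le_max_right _ _) ?_ (by positivity) (by positivity)
  refine mul_le_mul_of_nonneg_right ?_ (by positivity)
  exact (le_mul_of_one_le_right (by positivity) h1).trans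
    (le_mul_of_one_le_right (by positivity) h2)

theorem le_constC_of_one_le {α : ℝ} (hα1 : 1 ≤ α) : √2 * (4 * Real.exp 1) ≤ constC α := by
  rw [constC, if_neg hα1.not_gt]
  refine mul_le_mul (le_max_left _ _) ?_ (by positivity) (by positivity)
  have : 0 ≤ Real.log 2 ^ (1 / α) := Real.rpow_nonneg (Real.log_nonneg one_le_two) _
  linarith

theorem constC_pos {α : ℝ} (hα : 0 < α) : 0 < constC α := by
  rcases lt_or_ge α 1 with h | h
  · exact lt_of_lt_of_le (by positivity) (le_constC_of_lt_one hα h)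
  · exact lt_of_lt_of_le (by positivity) (le_constC_of_one_le h)

theorem one_le_conjExponent (p : ℝ≥0∞) : 1 ≤ ENNReal.conjExponent p := le_self_add

theorem paramL_nonneg {n : ℕ} {α : ℝ} (hα : 0 < α) (b : Fin n → ℝ) : 0 ≤ paramL α b := by
  have h0 := (constC_pos hα).le
  have h1 := vecNorm_nonneg (p := 2) (by norm_num) b
  have h2 := vecNorm_nonneg (p := ∞) le_top b
  have h3 := vecNorm_nonneg (one_le_conjExponent (ENNReal.ofReal α)) b
  rw [paramL]
  split_ifs <;> positivity

theorem sqrt_le_three_mul_sqrt {x s : ℝ} (h : x ≤ 9 * s) : √x ≤ 3 * √s := by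
  refine (Real.sqrt_le_sqrt h).trans (le_of_eq ?_)
  rw [Real.sqrt_mul (by norm_num), show (9 : ℝ) = 3 ^ 2 by norm_num, Real.sqrt_sq (by norm_num)]

theorem tail_bound_le_of_lt_one {n : ℕ} {α : ℝ} (hα : 0 < α) (hα1 : α < 1) {b : Fin n → ℝ}
    (hb : 0 < vecNorm 2 b) {x s : ℝ} (hx : 0 < x) (hxs : x ≤ 9 * s) :
    Real.exp 2 * (Real.exp 1 / (α * Real.exp 1) ^ (1 / α)) *
        (2 ^ (1 / α) * vecNorm 2 b * √x +
          2 * (Real.exp 1 * x) ^ (1 / α - 1) * x * vecNorm ∞ b) ≤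
      2 * Real.exp 1 * constC α * vecNorm 2 b * (√s + paramL α b * s ^ (1 / α)) := by
  have hs : 0 < s := by linarith
  have hC := le_constC_of_lt_one hα hα1
  have hC0 := constC_pos hα
  have hB' := vecNorm_nonneg (p := ∞) le_top b
  set B := vecNorm 2 b
  set B' := vecNorm ∞ b
  set C := constC α
  have he3 : Real.exp 3 = Real.exp 2 * Real.exp 1 := by rw [← Real.exp_add]; norm_num
  have he1 : 1 ≤ Real.exp 1 := Real.one_le_exp zero_le_one
  have h8 : √8 = 2 * √2 := by
    rw [show (8 : ℝ) = 2 ^ 2 * 2 by norm_num, Real.sqrt_mul (by norm_num),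
      Real.sqrt_sq (by norm_num)]
  have h2 : 1 ≤ √2 := Real.one_le_sqrt.mpr (by norm_num)
  have hαe : (α * Real.exp 1) ^ (1 / α) = α ^ (1 / α) * Real.exp 1 ^ (1 / α) :=
    Real.mul_rpow hα.le (by positivity)
  have hE : (1 : ℝ) ≤ Real.exp 1 ^ (1 / α) := Real.one_le_rpow he1 (by positivity)
  have hdiv : (Real.exp (2 / Real.exp 1) / α) ^ (1 / α) =
      Real.exp (2 / Real.exp 1) ^ (1 / α) / α ^ (1 / α) :=
    Real.div_rpow (by positivity) hα.le _
  have hα0 : 0 < α ^ (1 / α) := by positivity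
  have hQ : (1 : ℝ) + 2 / Real.exp 1 ≤ Real.exp (2 / Real.exp 1) := by
    rw [add_comm]
    exact Real.add_one_le_exp _
  have hQ1 : (1 : ℝ) ≤ Real.exp (2 / Real.exp 1) ^ (1 / α) :=
    Real.one_le_rpow (Real.one_le_exp (by positivity)) (by positivity)
  have hfirst : Real.exp 2 * (Real.exp 1 / (α * Real.exp 1) ^ (1 / α)) * 2 ^ (1 / α) * 3 ≤
      2 * Real.exp 1 * C := by
    have h4 : Real.exp 2 * (Real.exp 1 / (α * Real.exp 1) ^ (1 / α)) * 2 ^ (1 / α) ≤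
        2 ^ (1 / α) * (Real.exp 3 * (1 / α ^ (1 / α))) := by
      rw [hαe, he3]
      calc Real.exp 2 * (Real.exp 1 / (α ^ (1 / α) * Real.exp 1 ^ (1 / α))) * 2 ^ (1 / α)
          ≤ Real.exp 2 * (Real.exp 1 / (α ^ (1 / α) * 1)) * 2 ^ (1 / α) := by gcongr
        _ = _ := by ring
    have h5 : 2 ^ (1 / α) * (Real.exp 3 * (1 / α ^ (1 / α))) * 2 ≤ C := by
      refine le_trans ?_ hC
      rw [hdiv]
      calc 2 ^ (1 / α) * (Real.exp 3 * (1 / α ^ (1 / α))) * 2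
          = 2 ^ (1 / α) * (2 * Real.exp 3 * (1 / α ^ (1 / α))) := by ring
        _ ≤ _ := by
          gcongr
          rw [h8]
          linarith
    nlinarith
  have hL : 2 * Real.exp 1 * C * B * paramL α b =
      2 * Real.exp 1 * C * (4 ^ (1 / α) / √2) * B' := by
    have : paramL α b = 4 ^ (1 / α) / (√2 * B) * B' := by rw [paramL, if_pos hα1]
    rw [this]
    field_simp
  have hsecond : Real.exp 2 * (Real.exp 1 / (α * Real.exp 1) ^ (1 / α)) *
      (2 * (Real.exp 1 * x) ^ (1 / α - 1) * x) ≤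
      2 * Real.exp 1 * C * (4 ^ (1 / α) / √2) * s ^ (1 / α) := by
    -- The `9` from `x ≤ 9 s` is paid by `2 * 4 * e ^ (2/e) ≥ 8 (1 + 2/e) ≥ 9`: the `2` and `e ^
    -- (2/e)` come from `constC`, the `4` from `paramL`.
    have h9 : (9 : ℝ) ^ (1 / α) ≤
        2 ^ (1 / α) * 4 ^ (1 / α) * Real.exp (2 / Real.exp 1) ^ (1 / α) := by
      rw [← Real.mul_rpow (by norm_num) (by norm_num),
        ← Real.mul_rpow (by norm_num) (by positivity)]
      refine Real.rpow_le_rpow (by norm_num) ?_ (by positivity)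
      have : 1 / 8 ≤ 2 / Real.exp 1 := by
        rw [div_le_div_iff₀ (by norm_num) (by positivity)]
        linarith [Real.exp_one_lt_d9]
      linarith
    calc Real.exp 2 * (Real.exp 1 / (α * Real.exp 1) ^ (1 / α)) *
          (2 * (Real.exp 1 * x) ^ (1 / α - 1) * x)
        = 2 * Real.exp 2 * x ^ (1 / α) / α ^ (1 / α) := by
          rw [Real.rpow_sub_one (by positivity), hαe,
            Real.mul_rpow (x := Real.exp 1) (by positivity) hx.le]
          field_simp
      _ ≤ 2 * Real.exp 2 * (9 * s) ^ (1 / α) / α ^ (1 / α) := by gcongr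
      _ = 2 * Real.exp 2 * 9 ^ (1 / α) * s ^ (1 / α) / α ^ (1 / α) := by
          rw [Real.mul_rpow (by norm_num) hs.le]
          ring
      _ ≤ 2 * Real.exp 2 * (2 ^ (1 / α) * 4 ^ (1 / α) * Real.exp (2 / Real.exp 1) ^ (1 / α)) *
          s ^ (1 / α) / α ^ (1 / α) := by gcongr
      _ ≤ 2 * Real.exp 2 * (2 ^ (1 / α) * 4 ^ (1 / α) * Real.exp (2 / Real.exp 1) ^ (1 / α)) *
          s ^ (1 / α) / α ^ (1 / α) * (2 * Real.exp 1 * Real.exp 1) := by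
          refine le_mul_of_one_le_right (by positivity) ?_
          nlinarith
      _ = 2 * Real.exp 1 * (2 ^ (1 / α) * (√8 * Real.exp 3 *
          (Real.exp (2 / Real.exp 1) / α) ^ (1 / α))) * (4 ^ (1 / α) / √2) * s ^ (1 / α) := by
          rw [hdiv, he3, h8]
          field_simp
      _ ≤ _ := by gcongr
  calc Real.exp 2 * (Real.exp 1 / (α * Real.exp 1) ^ (1 / α)) *
        (2 ^ (1 / α) * B * √x + 2 * (Real.exp 1 * x) ^ (1 / α - 1) * x * B')
      ≤ Real.exp 2 * (Real.exp 1 / (α * Real.exp 1) ^ (1 / α)) *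
        (2 ^ (1 / α) * B * (3 * √s) + 2 * (Real.exp 1 * x) ^ (1 / α - 1) * x * B') := by
        gcongr
        exact sqrt_le_three_mul_sqrt hxs
    _ = Real.exp 2 * (Real.exp 1 / (α * Real.exp 1) ^ (1 / α)) * 2 ^ (1 / α) * 3 * (B * √s) +
        Real.exp 2 * (Real.exp 1 / (α * Real.exp 1) ^ (1 / α)) *
          (2 * (Real.exp 1 * x) ^ (1 / α - 1) * x) * B' := by ring
    _ ≤ 2 * Real.exp 1 * C * (B * √s) +
        2 * Real.exp 1 * C * (4 ^ (1 / α) / √2) * s ^ (1 / α) * B' := by gcongr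
    _ = 2 * Real.exp 1 * C * B * (√s + paramL α b * s ^ (1 / α)) := by
        rw [mul_add, ← mul_assoc (2 * Real.exp 1 * C * B), hL]
        ring

theorem tail_bound_le_of_one_le {n : ℕ} {α : ℝ} (hα1 : 1 ≤ α) {b : Fin n → ℝ}
    (hb : 0 < vecNorm 2 b) {x s : ℝ} (hx : 0 < x) (hxs : x ≤ 9 * s) :
    Real.exp 2 * (√(4 * Real.exp 1) * vecNorm 2 b * √x +
        x * (vecNorm (ENNReal.conjExponent (ENNReal.ofReal α)) b * (x / 4) ^ (1 / α - 1))) ≤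
      2 * Real.exp 1 * constC α * vecNorm 2 b * (√s + paramL α b * s ^ (1 / α)) := by
  have hα : 0 < α := by linarith
  have hs : 0 < s := by linarith
  have hC := le_constC_of_one_le hα1
  have hC0 := constC_pos hα
  have hB' := vecNorm_nonneg (one_le_conjExponent (ENNReal.ofReal α)) b
  have he2 : Real.exp 2 = Real.exp 1 * Real.exp 1 := by rw [← Real.exp_add]; norm_num
  have hL : 2 * Real.exp 1 * constC α * vecNorm 2 b * paramL α b = 2 * Real.exp 1 *
      (4 ^ (1 / α) / √2) *
        (4 * Real.exp 1 * vecNorm (ENNReal.conjExponent (ENNReal.ofReal α)) b) := by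
    rw [paramL, if_neg hα1.not_gt]
    field_simp
  set B := vecNorm 2 b
  set B' := vecNorm (ENNReal.conjExponent (ENNReal.ofReal α)) b
  set C := constC α
  have hfirst : Real.exp 2 * (√(4 * Real.exp 1) * 3) ≤ 2 * Real.exp 1 * C := by
    -- After squaring this is `36 e ≤ 128`.
    have h1 : √(4 * Real.exp 1) * 3 ≤ 8 * √2 := by
      refine abs_le_of_sq_le_sq' ?_ (by positivity) |>.2
      rw [mul_pow, mul_pow, Real.sq_sqrt (by positivity), Real.sq_sqrt (by positivity)]
      linarith [Real.exp_one_lt_d9]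
    calc Real.exp 2 * (√(4 * Real.exp 1) * 3) ≤ Real.exp 2 * (8 * √2) := by gcongr
      _ = 2 * Real.exp 1 * (√2 * (4 * Real.exp 1)) := by rw [he2]; ring
      _ ≤ _ := by gcongr
  have hsecond : Real.exp 2 * (x * (x / 4) ^ (1 / α - 1)) ≤
      2 * Real.exp 1 * (4 ^ (1 / α) / √2) * (4 * Real.exp 1) * s ^ (1 / α) := by
    have h2 : √2 ≤ 2 := Real.sqrt_le_iff.mpr (by norm_num)
    calc Real.exp 2 * (x * (x / 4) ^ (1 / α - 1)) = Real.exp 2 * 4 * (x / 4) ^ (1 / α) := by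
          rw [Real.rpow_sub_one (by positivity)]
          field_simp
      -- `x / 4 ≤ 9 s / 4 ≤ 4 s`, which matches the `4 ^ (1 / α)` in `paramL`.
      _ ≤ Real.exp 2 * 4 * (4 * s) ^ (1 / α) := by
          gcongr
          linarith
      _ = Real.exp 2 * 4 * (4 ^ (1 / α) / √2) * √2 * s ^ (1 / α) := by
          rw [Real.mul_rpow (by norm_num) hs.le]
          field_simp
      _ ≤ Real.exp 2 * 4 * (4 ^ (1 / α) / √2) * 2 * s ^ (1 / α) := by gcongr
      _ = _ := by rw [he2]; ring
  calc Real.exp 2 * (√(4 * Real.exp 1) * B * √x + x * (B' * (x / 4) ^ (1 / α - 1)))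
      ≤ Real.exp 2 * (√(4 * Real.exp 1) * B * (3 * √s) +
          x * (B' * (x / 4) ^ (1 / α - 1))) := by
        gcongr
        exact sqrt_le_three_mul_sqrt hxs
    _ = Real.exp 2 * (√(4 * Real.exp 1) * 3) * (B * √s) +
        Real.exp 2 * (x * (x / 4) ^ (1 / α - 1)) * B' := by ring
    _ ≤ 2 * Real.exp 1 * C * (B * √s) +
        2 * Real.exp 1 * (4 ^ (1 / α) / √2) * (4 * Real.exp 1) * s ^ (1 / α) * B' := by gcongr
    _ = 2 * Real.exp 1 * C * B * (√s + paramL α b * s ^ (1 / α)) := by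
        rw [mul_add, ← mul_assoc (2 * Real.exp 1 * C * B), hL]
        ring

theorem IsNormalizedFamily.tail_gbo [IsProbabilityMeasure μ] {n : ℕ} {α : ℝ}
    {Z : Fin n → Ω → ℝ} (hZ : IsNormalizedFamily α Z μ) (hα : 0 < α) {b : Fin n → ℝ}
    (hb : 0 < vecNorm 2 b) {s : ℝ} {N : ℕ} (hN : Even N) (hN0 : N ≠ 0) (hNs : (N : ℝ) ≤ 9 * s) :
    μ.real {ω | 2 * Real.exp 1 * constC α * vecNorm 2 b * (√s + paramL α b * s ^ (1 / α)) ≤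
      |∑ i, b i * Z i ω|} ≤ Real.exp (-N) := by
  have hNpos : (0 : ℝ) < N := by positivity
  have hB := (sum_sq_eq_vecNorm_sq b).le
  rcases lt_trichotomy α 1 with h | rfl | h
  · refine (measureReal_mono fun ω hω => ?_).trans (hZ.tail_of_le_one hα h.le hb
      (vecNorm_nonneg le_top b) hB (abs_le_vecNorm_top b) hN hN0)
    exact (tail_bound_le_of_lt_one hα h hb hNpos hNs).trans hω
  · refine (measureReal_mono fun ω hω => ?_).trans (hZ.tail_of_one hb
      (vecNorm_nonneg le_top b) hB (abs_le_vecNorm_top b) hN hN0)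
    have h1 := (tail_bound_le_of_one_le le_rfl hb hNpos hNs).trans hω
    have h2 : ENNReal.conjExponent (ENNReal.ofReal 1) = ∞ := by simp [ENNReal.conjExponent]
    rw [h2] at h1
    simpa using h1
  · have hp : 1 < (ENNReal.ofReal α).toReal := by rwa [ENNReal.toReal_ofReal hα.le]
    have := ENNReal.HolderConjugate.conjExponent (p := ENNReal.ofReal α)
      (ENNReal.one_le_ofReal.mpr h.le)
    have hconj : α.HolderConjugate (ENNReal.conjExponent (ENNReal.ofReal α)).toReal := by
      have := ENNReal.HolderConjugate.toReal (q := ENNReal.conjExponent (ENNReal.ofReal α)) hp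
      rwa [ENNReal.toReal_ofReal hα.le] at this
    refine (measureReal_mono fun ω hω => ?_).trans (hZ.tail_of_holderConjugate hconj hb
      (vecNorm_nonneg (one_le_conjExponent (ENNReal.ofReal α)) b) hB
      (sum_abs_rpow_eq_vecNorm_rpow hconj.symm.pos b).le hN hN0)
    exact (tail_bound_le_of_one_le h.le hb hNpos hNs).trans hω

end

end GBO

theorem mainTheorem4 {Ω : Type*} [MeasurableSpace Ω] (μ : Measure Ω) [IsProbabilityMeasure μ]
    (n : ℕ) (X : Fin n → Ω → ℝ) (hmeas : ∀ i, Measurable (X i)) (hindep : iIndepFun X μ)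
    (hmean : ∀ i, ∫ ω, X i ω ∂μ = 0)
    (α : ℝ) (hα : 0 < α) (hfin : ∀ i, GBO.orliczNorm (GBO.psi α) (X i) μ < ∞)
    (a b : Fin n → ℝ)
    (hb : ∀ i, b i = a i * (GBO.orliczNorm (GBO.psi α) (X i) μ).toReal) :
    GBO.orliczNorm (GBO.gboPsi α (GBO.paramL α b)) (fun ω => ∑ i, a i * X i ω) μ
      ≤ ENNReal.ofReal (2 * Real.exp 1 * GBO.constC α * GBO.vecNorm 2 b) := by
  have hsum := GBO.sum_mul_ae_eq_sum_div_orliczNorm hmeas hα hfin hb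
  have hL := GBO.paramL_nonneg hα b
  rw [GBO.orliczNorm_congr_ae hsum]
  -- The tail argument needs a positive scale `η`, so `b = 0` is treated apart; the sum is then
  -- identically zero.
  rcases (GBO.vecNorm_nonneg (p := 2) (by norm_num) b).eq_or_lt with h0 | hpos
  · have hb0 : ∀ i, b i = 0 := by
      have h1 := GBO.sum_sq_eq_vecNorm_sq b
      rw [← h0, zero_pow two_ne_zero, Finset.sum_eq_zero_iff_of_nonneg fun i _ => sq_nonneg _] at h1
      exact fun i => pow_eq_zero_iff two_ne_zero |>.mp (h1 i (Finset.mem_univ i))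
    rw [GBO.orliczNorm_gboPsi_of_ae_eq_zero hα hL]
    · exact zero_le
    · filter_upwards with ω
      simp [hb0]
  · have hZ := GBO.isNormalizedFamily_div_orliczNorm hmeas hindep hmean hα hfin
    have hC := GBO.constC_pos hα
    refine GBO.orliczNorm_gboPsi_le_of_tail hα hL (by positivity) (by fun_prop)
      fun s _ N hN hN0 hNs => hZ.tail_gbo hα hpos hN hN0 hNs
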